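/- \textbf{Theorem 3.} Let $m,n$ be integers with $m\ge 1$, $n\ge 0$, and let $f_{(1)},\dots,f_{(m)}:\mathbb R^n\to\mathbb R$ be convex and differentiable with $L$-Lipschitz gradients, $L>0$. Let $F=\frac1m\sum_{i=1}^m f_{(i)}$ and let $x^*$ be a minimizer of $F$. Local variables $v_{(1)},\dots,v_{(m)}\in\mathbb R^n$ are collected as the rows of a matrix $\mathbf v\in\mathbb R^{m\times n}$; write $\overline v=\frac1m\sum_i v_{(i)}$, $\Pi=I-\frac1m\mathbf 1\mathbf 1^T$, $\|\cdot\|$ for the Euclidean (Frobenius) norm, $\|\cdot\|_2$ for the spectral norm, and $\nabla f(\mathbf v)\in\mathbb R^{m\times n}$ for the matrix with rows $\nabla f_{(i)}(v_{(i)})^T$. Let $\{W_1^k\}_{k\ge0},\{W_2^k\}_{k\ge0},\{W_3^k\}_{k\ge0}$ be sequences of real $m\times m$ matrices and $\gamma\ge1$ an integer such that for each $q\in\{1,2,3\}$: (i) there are edge sets $\mathcal E_q^k\subseteq\{1,\dots,m\}^2$ with $(W_q^k)_{i,j}>0$ if $(i,j)\in\mathcal E_q^k$ or $i=j$, and $(W_q^k)_{i,j}=0$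 otherwise; (ii) $W_q^k\mathbf 1=\mathbf 1$ and $\mathbf 1^TW_q^k=\mathbf 1^T$ for all $k$; (iii) $\sigma_{\gamma,q}:=\sup_{k\ge\gamma-1}\|W_q^kW_q^{k-1}\cdots W_q^{k-\gamma+1}-\frac1m\mathbf 1\mathbf 1^T\|_2<1$. Put $\sigma_\gamma=\max_{q}\sigma_{\gamma,q}$. Let $\theta_0=1$ and let $\theta_k>0$ be given by $\frac{1-\theta_k}{\theta_k^2}=\frac1{\theta_{k-1}^2}$ for $k\ge1$, and let $0<\alpha\le\frac{(1-\sigma_\gamma)^4}{21675L\gamma^4}$. Let $\mathbf x^0=\mathbf y^0=\mathbf z^0$ with $\Pi\mathbf x^0=0$ and $\mathbf s^0=\nabla f(\mathbf y^0)$, and let, for $k\ge0$ (for $k\ge1$ in the second equation), $$\mathbf y^k=\theta_k\mathbf z^k+(1-\theta_k)\mathbf x^k,\qquad \mathbf s^k=W_1^k\mathbf s^{k-1}+\nabla f(\mathbf y^k)-\nabla f(\mathbf y^{k-1}),$$ $$\mathbf z^{k+1}=W_2^k\mathbf z^k-\frac{\alpha}{\theta_k}\mathbf s^k,\qquad \mathbf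 x^{k+1}=\theta_k\mathbf z^{k+1}+(1-\theta_k)W_3^k\mathbf x^k .$$ Then for every integer $T\ge0$ $$F(\overline x^{T\gamma+1})-F(x^*)\le\frac1{(T\gamma+1)^2}\left(\frac2\alpha\|\overline z^0-x^*\|^2+\frac{1-\sigma_\gamma}{5mL\gamma}\max_{r=0,\dots,\gamma}\|\Pi\mathbf s^r\|^2\right)$$ and $$\frac1m\|\Pi\mathbf x^{T\gamma}\|^2\le\frac9{2L(T\gamma+1)^2}\left(\frac2\alpha\|\overline z^0-x^*\|^2+\frac{1-\sigma_\gamma}{5mL\gamma}\max_{r=0,\dots,\gamma}\|\Pi\mathbf s^r\|^2\right).$$ -/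

import Mathlib

namespace AccGT

noncomputable section

/-- An aggregate variable in `ℝ^{m × n}`: the `i`-th row is the local variable of agent `i`. -/
abbrev Agg (m n : ℕ) := Fin m → EuclideanSpace ℝ (Fin n)

/-- The global objective `F(x) = (1/m) ∑ᵢ fᵢ(x)`. -/
def objective {m n : ℕ} (f : Fin m → EuclideanSpace ℝ (Fin n) → ℝ)
    (x : EuclideanSpace ℝ (Fin n)) : ℝ :=
  (1 / (m : ℝ)) * ∑ i, f i x

/-- The average of the local variables. -/
def avg {m n : ℕ} (X : Agg m n) : EuclideanSpace ℝ (Fin n) :=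
  (1 / (m : ℝ)) • ∑ i, X i

/-- The operator `Π = I - (1/m) 𝟏𝟏ᵀ` measuring the consensus violation. -/
def consensusErr {m n : ℕ} (X : Agg m n) : Agg m n :=
  fun i => X i - avg X

/-- The squared Frobenius norm of an aggregate variable. -/
def frobSq {m n : ℕ} (X : Agg m n) : ℝ :=
  ∑ i, ‖X i‖ ^ 2

/-- The matrix product `W X` of a weight matrix and an aggregate variable. -/
def mix {m n : ℕ} (W : Matrix (Fin m) (Fin m) ℝ) (X : Agg m n) : Agg m n :=
  fun i => ∑ j, W i j • X j

/-- The aggregate gradient: its `i`-th row is `∇fᵢ(xᵢ)`. -/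
def aggGrad {m n : ℕ} (f : Fin m → EuclideanSpace ℝ (Fin n) → ℝ) (X : Agg m n) : Agg m n :=
  fun i => gradient (f i) (X i)

/-- `g` is `μ`-strongly convex (convex if `μ = 0`) and `L`-smooth. -/
structure StronglyConvexSmooth {n : ℕ} (μ L : ℝ) (g : EuclideanSpace ℝ (Fin n) → ℝ) : Prop where
  differentiable : Differentiable ℝ g
  strongly_convex : ∀ x y, g x + inner ℝ (gradient g x) (y - x) + μ / 2 * ‖y - x‖ ^ 2 ≤ g y
  lipschitz_gradient : ∀ x y, ‖gradient g y - gradient g x‖ ≤ L * ‖y - x‖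

/-- The product `W^{a+t-1} ⋯ W^{a+1} W^a` of `t` consecutive weight matrices, starting at time `a`
(for `t = 0` it is the identity); in terms of the last index `k = a+t-1` it is `W^{k,t}`. -/
def windowProd {m : ℕ} (W : ℕ → Matrix (Fin m) (Fin m) ℝ) (a : ℕ) : ℕ → Matrix (Fin m) (Fin m) ℝ
  | 0 => 1
  | t + 1 => W (a + t) * windowProd W a t

/-- The averaging matrix `(1/m) 𝟏𝟏ᵀ`. -/
def avgMatrix (m : ℕ) : Matrix (Fin m) (Fin m) ℝ :=
  Matrix.of fun _ _ => 1 / (m : ℝ)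

/-- The spectral norm (largest singular value) of a matrix. -/
def spectralNorm {m : ℕ} (A : Matrix (Fin m) (Fin m) ℝ) : ℝ :=
  ‖Matrix.toEuclideanCLM (n := Fin m) (𝕜 := ℝ) A‖

/-- `σ_γ`, the supremum over `k ≥ γ - 1` of `‖W^{k,γ} - (1/m) 𝟏𝟏ᵀ‖₂`; here `a = k - γ + 1`. -/
def jointSigma {m : ℕ} (W : ℕ → Matrix (Fin m) (Fin m) ℝ) (γ : ℕ) : ℝ :=
  ⨆ a : ℕ, spectralNorm (windowProd W a γ - avgMatrix m)

/-- Weight matrices `W^k` over the time-varying graphs with edge sets `E^k`: decentralized,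
doubly stochastic, with the `γ`-step joint spectrum property. -/
structure TimeVaryingWeights {m : ℕ} (E : ℕ → Set (Fin m × Fin m))
    (W : ℕ → Matrix (Fin m) (Fin m) ℝ) (γ : ℕ) : Prop where
  pos_iff : ∀ k i j, 0 < W k i j ↔ ((i, j) ∈ E k ∨ i = j)
  eq_zero : ∀ k i j, ¬((i, j) ∈ E k ∨ i = j) → W k i j = 0
  row_sum : ∀ k i, ∑ j, W k i j = 1
  col_sum : ∀ k j, ∑ i, W k i j = 1
  one_le_gamma : 1 ≤ γ
  jointSigma_lt_one : jointSigma W γ < 1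

/-- The Nesterov parameters: `θ₀ = 1` and `(1 - θ_k) / θ_k² = 1 / θ_{k-1}²`, taking at each step the
positive root of this quadratic equation. -/
structure IsNesterovSeq (θ : ℕ → ℝ) : Prop where
  zero : θ 0 = 1
  pos : ∀ k, 0 < θ k
  step : ∀ k, (1 - θ (k + 1)) / θ (k + 1) ^ 2 = 1 / θ k ^ 2

/-- The sequences `x, y, z, s` are the iterates of accelerated gradient tracking with step size `α`,
strong convexity parameter `μ`, extrapolation parameters `θ` and weight matrices `W₁, W₂, W₃`,
started from a common point shared by all agents. -/
structure IsAccGradientTracking {m n : ℕ} (μ α : ℝ) (θ : ℕ → ℝ)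
    (W₁ W₂ W₃ : ℕ → Matrix (Fin m) (Fin m) ℝ) (f : Fin m → EuclideanSpace ℝ (Fin n) → ℝ)
    (x y z s : ℕ → Agg m n) : Prop where
  init_y : y 0 = x 0
  init_z : z 0 = x 0
  init_consensus : consensusErr (x 0) = 0
  init_s : s 0 = aggGrad f (y 0)
  step_y : ∀ k, y k = θ k • z k + (1 - θ k) • x k
  step_s : ∀ k, s (k + 1) = mix (W₁ (k + 1)) (s k) + aggGrad f (y (k + 1)) - aggGrad f (y k)
  step_z : ∀ k, z (k + 1) = (1 / (1 + μ * α / θ k)) •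
    (mix (W₂ k) ((μ * α / θ k) • y k + z k) - (α / θ k) • s k)
  step_x : ∀ k, x (k + 1) = θ k • z (k + 1) + (1 - θ k) • mix (W₃ k) (x k)

end

end AccGT

/-!
The averaged iterates perform Nesterov's accelerated method on the global objective `F`, except that
the gradient used at step `k` is the average of the local gradients at the rows of `y k` rather than
the gradient of `F` at their average. Writing `t k = 1 / θ k`, the standard potential argument
(`accelerated_step`, `IsAccGradientTracking.sum_descent`) gives, after multiplication by `t k ^ 2`
and summation,

  `t K ^ 2 * (F (x̄ (K + 1)) - F x*) + D + (1 / (2 α) - L) Δ`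
    `≤ ‖z̄ 0 - x*‖² / (2 α) + (L / m) ∑ t k ^ 2 * ‖Π y k‖²`,

where `D` collects the Bregman divergences of `x̄ k` from the rows of `y k`, weighted by
`t (k - 1) ^ 2`, and `Δ` the squared movements of `z̄`. It remains to pay for the consensus errors on the right.

Set `τ = γ / (1 - σ)`. A mean-zero variable mixed by the weight matrices shrinks by `σ` over every
window of `γ` steps, so the map from perturbations to consensus errors is bounded on square sums,
with squared gain of order `τ ^ 2` (`isWindowContraction_of_mix`,
`IsWindowContraction.sum_sq_le_of_zero`). The rescaled error `t (k - 1) Π x k` is such a recursion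
driven by `Π z (k + 1)`, and `Π z k` is one driven by `α t k Π s k`; this costs `α ^ 2 τ ^ 4`. The
tracker `Π s k` carries the growing weight `t k`, which raises the gain to order `τ ^ 4` and the
contribution of the initial errors to order `τ ^ 3` (`IsWindowContraction.sum_weighted_sq_le`).
Finally the changes of the gradients that drive `s` are controlled by `D`, by `Δ`, and by the
consensus errors of `y` themselves, through cocoercivity of the gradients
(`IsAccGradientTracking.sq_grad_change_le`). The loop gain is thus a multiple of `(α L τ ^ 4) ^ 2`,
which is tiny for the admissible step sizes, so `D` and `Δ` absorb the errors (`small_gain`) up to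
the initial tracking error. The rates follow from `t k ≥ (k + 2) / 2`.
-/

namespace AccGT

/-! ### Smooth convex functions -/

section Smooth

variable {n : ℕ} {L : ℝ} {g : EuclideanSpace ℝ (Fin n) → ℝ}

theorem StronglyConvexSmooth.gradient_ineq (hg : StronglyConvexSmooth 0 L g)
    (y w : EuclideanSpace ℝ (Fin n)) : g y + inner ℝ (gradient g y) (w - y) ≤ g w := by
  simpa using hg.strongly_convex y w

/-- The descent lemma with `L` in place of the sharp constant `L / 2`, which needs only the gradient
inequality at `w` and the Lipschitz bound. -/
theorem StronglyConvexSmooth.le_add_sq (hg : StronglyConvexSmooth 0 L g)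
    (y w : EuclideanSpace ℝ (Fin n)) :
    g w ≤ g y + inner ℝ (gradient g y) (w - y) + L * ‖w - y‖ ^ 2 := by
  have h1 := hg.gradient_ineq w y
  have h2 : inner ℝ (gradient g w - gradient g y) (w - y) ≤ L * ‖w - y‖ ^ 2 := by
    calc inner ℝ (gradient g w - gradient g y) (w - y)
        ≤ ‖gradient g w - gradient g y‖ * ‖w - y‖ := real_inner_le_norm _ _
      _ ≤ (L * ‖w - y‖) * ‖w - y‖ := by
          gcongr
          exact hg.lipschitz_gradient y w
      _ = L * ‖w - y‖ ^ 2 := by ring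
  rw [inner_sub_left] at h2
  rw [← neg_sub w y, inner_neg_right] at h1
  linarith

/-- The Bregman divergence of `g` dominates the squared difference of the gradients: compare the
descent lemma at a gradient step from `w` with the gradient inequality at `y`. -/
theorem StronglyConvexSmooth.sq_gradient_sub_le (hL : 0 < L) (hg : StronglyConvexSmooth 0 L g)
    (y w : EuclideanSpace ℝ (Fin n)) :
    ‖gradient g w - gradient g y‖ ^ 2 ≤
      4 * L * (g w - g y - inner ℝ (gradient g y) (w - y)) := by
  set d := gradient g w - gradient g y with hd
  have h1 := hg.le_add_sq w (w - (1 / (2 * L)) • d)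
  have h2 := hg.gradient_ineq y (w - (1 / (2 * L)) • d)
  have e1 : w - (1 / (2 * L)) • d - w = -((1 / (2 * L)) • d) := by abel
  have e2 : w - (1 / (2 * L)) • d - y = (w - y) - (1 / (2 * L)) • d := by abel
  rw [e1, norm_neg, inner_neg_right, norm_smul, inner_smul_right] at h1
  rw [e2, inner_sub_right, inner_smul_right] at h2
  have h3 : inner ℝ (gradient g w) d - inner ℝ (gradient g y) d = ‖d‖ ^ 2 := by
    rw [← inner_sub_left, ← hd, real_inner_self_eq_norm_sq]
  have h4 : L * (‖1 / (2 * L)‖ * ‖d‖) ^ 2 = 1 / (4 * L) * ‖d‖ ^ 2 := by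
    rw [Real.norm_of_nonneg (by positivity)]
    field_simp
    ring
  have h5 : 1 / (2 * L) * ‖d‖ ^ 2 - 1 / (4 * L) * ‖d‖ ^ 2 ≤
      g w - g y - inner ℝ (gradient g y) (w - y) := by
    rw [← h3] at *
    linarith
  have h6 : 1 / (2 * L) * ‖d‖ ^ 2 - 1 / (4 * L) * ‖d‖ ^ 2 = ‖d‖ ^ 2 / (4 * L) := by
    field_simp
    ring
  rw [h6, div_le_iff₀ (by positivity)] at h5
  linarith

end Smooth

/-! ### Averages, consensus errors and Frobenius norms -/

section Aggregate

variable {m n : ℕ}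

theorem avg_add (X Y : Agg m n) : avg (X + Y) = avg X + avg Y := by
  simp [avg, Finset.sum_add_distrib, smul_add]

theorem avg_sub (X Y : Agg m n) : avg (X - Y) = avg X - avg Y := by
  simp [avg, Finset.sum_sub_distrib, smul_sub]

theorem avg_smul (c : ℝ) (X : Agg m n) : avg (c • X) = c • avg X := by
  simp only [avg, Pi.smul_apply]
  rw [← Finset.smul_sum, smul_comm]

theorem avg_mix {W : Matrix (Fin m) (Fin m) ℝ} (hW : ∀ j, ∑ i, W i j = 1) (X : Agg m n) :
    avg (mix W X) = avg X := by
  simp only [avg, mix]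
  rw [Finset.sum_comm]
  simp only [← Finset.sum_smul, hW, one_smul]

theorem sum_eq_smul_avg (hm : 1 ≤ m) (X : Agg m n) : ∑ i, X i = (m : ℝ) • avg X := by
  have : (m : ℝ) ≠ 0 := by positivity
  simp [avg, smul_smul, this]

theorem avg_consensusErr (hm : 1 ≤ m) (X : Agg m n) : avg (consensusErr X) = 0 := by
  change (1 / (m : ℝ)) • ∑ i, (X i - avg X) = 0
  rw [Finset.sum_sub_distrib, sum_eq_smul_avg hm, Finset.sum_const, Finset.card_univ,
    Fintype.card_fin, ← Nat.cast_smul_eq_nsmul ℝ, sub_self, smul_zero]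

theorem consensusErr_add (X Y : Agg m n) :
    consensusErr (X + Y) = consensusErr X + consensusErr Y := by
  funext i
  simp only [consensusErr, avg_add, Pi.add_apply]
  abel

theorem consensusErr_smul (c : ℝ) (X : Agg m n) :
    consensusErr (c • X) = c • consensusErr X := by
  funext i
  simp only [consensusErr, avg_smul, Pi.smul_apply, smul_sub]

theorem consensusErr_mix {W : Matrix (Fin m) (Fin m) ℝ} (hrow : ∀ i, ∑ j, W i j = 1)
    (hcol : ∀ j, ∑ i, W i j = 1) (X : Agg m n) :
    consensusErr (mix W X) = mix W (consensusErr X) := by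
  funext i
  change mix W X i - avg (mix W X) = ∑ j, W i j • (X j - avg X)
  rw [avg_mix hcol]
  simp only [mix, smul_sub, Finset.sum_sub_distrib, ← Finset.sum_smul, hrow, one_smul]

theorem frobSq_nonneg (X : Agg m n) : 0 ≤ frobSq X :=
  Finset.sum_nonneg fun _ _ => sq_nonneg _

/-- The bias-variance decomposition of the squared distances to a common point. -/
theorem sum_sq_dist (hm : 1 ≤ m) (X : Agg m n) (w : EuclideanSpace ℝ (Fin n)) :
    ∑ i, ‖w - X i‖ ^ 2 = m * ‖w - avg X‖ ^ 2 + frobSq (consensusErr X) := by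
  have h : ∀ i, ‖w - X i‖ ^ 2 = ‖w - avg X‖ ^ 2
      - 2 * inner ℝ (w - avg X) (consensusErr X i) + ‖consensusErr X i‖ ^ 2 := by
    intro i
    rw [← norm_sub_sq_real]
    simp [consensusErr]
  have h0 : ∑ i, inner ℝ (w - avg X) (consensusErr X i) = 0 := by
    rw [← inner_sum, sum_eq_smul_avg hm, avg_consensusErr hm, smul_zero, inner_zero_right]
  simp only [h, Finset.sum_add_distrib, Finset.sum_sub_distrib, ← Finset.mul_sum, h0, frobSq]
  simp

theorem frobSq_consensusErr_le (hm : 1 ≤ m) (X : Agg m n) :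
    frobSq (consensusErr X) ≤ frobSq X := by
  have h := sum_sq_dist hm X 0
  simp only [zero_sub, norm_neg] at h
  rw [frobSq.eq_1 X, h]
  have : 0 ≤ (m : ℝ) * ‖avg X‖ ^ 2 := by positivity
  linarith

/-- The Frobenius norm of an aggregate variable. -/
noncomputable def frobNorm (X : Agg m n) : ℝ := √(frobSq X)

theorem frobNorm_eq_norm (X : Agg m n) : frobNorm X = ‖WithLp.toLp 2 X‖ := by
  rw [PiLp.norm_eq_of_L2]
  rfl

theorem frobNorm_nonneg (X : Agg m n) : 0 ≤ frobNorm X := Real.sqrt_nonneg _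

theorem frobNorm_sq (X : Agg m n) : frobNorm X ^ 2 = frobSq X := Real.sq_sqrt (frobSq_nonneg X)

theorem frobNorm_add_le (X Y : Agg m n) : frobNorm (X + Y) ≤ frobNorm X + frobNorm Y := by
  simp only [frobNorm_eq_norm, WithLp.toLp_add]
  exact norm_add_le _ _

theorem frobNorm_smul (c : ℝ) (X : Agg m n) : frobNorm (c • X) = |c| * frobNorm X := by
  simp only [frobNorm_eq_norm, WithLp.toLp_smul, norm_smul, Real.norm_eq_abs]

end Aggregate

/-! ### Windowed linear recursions of real sequences -/

section Scalar

/-- `a` is driven by `b` and contracts by the factor `σ` over every window of length `γ`. -/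
structure IsWindowContraction (γ : ℕ) (σ : ℝ) (a b : ℕ → ℝ) : Prop where
  nonneg_left : ∀ k, 0 ≤ a k
  nonneg_right : ∀ k, 0 ≤ b k
  step : ∀ k, a (k + 1) ≤ a k + b k
  window : ∀ k, a (k + γ) ≤ σ * a k + ∑ j ∈ Finset.range γ, b (k + j)

variable {γ : ℕ} {σ : ℝ} {a b : ℕ → ℝ}

/-- Squared form of the window contraction, by convexity of the square with weights `σ`, `1 - σ`
and Cauchy-Schwarz for the sum over the window. -/
theorem IsWindowContraction.sq_le (h : IsWindowContraction γ σ a b) (hσ0 : 0 ≤ σ) (hσ1 : σ < 1)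
    (k : ℕ) :
    a (k + γ) ^ 2 ≤ σ * a k ^ 2 + γ / (1 - σ) * ∑ j ∈ Finset.range γ, b (k + j) ^ 2 := by
  set B := ∑ j ∈ Finset.range γ, b (k + j) with hB
  have hs : 0 < 1 - σ := by linarith
  have h1 : a (k + γ) ^ 2 ≤ (σ * a k + B) ^ 2 :=
    pow_le_pow_left₀ (h.nonneg_left _) (h.window k) 2
  have h2 : B ^ 2 ≤ γ * ∑ j ∈ Finset.range γ, b (k + j) ^ 2 := by
    simpa using sq_sum_le_card_mul_sum_sq (s := Finset.range γ) (f := fun j => b (k + j))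
  have h3 : (σ * a k + B) ^ 2 ≤ σ * a k ^ 2 + B ^ 2 / (1 - σ) := by
    have : σ * a k ^ 2 + B ^ 2 / (1 - σ) - (σ * a k + B) ^ 2
        = σ * ((1 - σ) * a k - B) ^ 2 / (1 - σ) := by
      field_simp
      ring
    have h4 : 0 ≤ σ * ((1 - σ) * a k - B) ^ 2 / (1 - σ) := by positivity
    linarith
  have h5 : B ^ 2 / (1 - σ) ≤ γ / (1 - σ) * ∑ j ∈ Finset.range γ, b (k + j) ^ 2 := by
    rw [div_mul_eq_mul_div]
    gcongr
  linarith

/-- Every index lies in at most `γ` windows of length `γ`. -/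
theorem sum_window_le (γ M : ℕ) {c : ℕ → ℝ} (hc : ∀ k, 0 ≤ c k) :
    ∑ k ∈ Finset.range (M + 1), ∑ j ∈ Finset.range γ, c (k + j)
      ≤ γ * ∑ i ∈ Finset.range (M + γ), c i := by
  rw [Finset.sum_comm]
  calc ∑ j ∈ Finset.range γ, ∑ k ∈ Finset.range (M + 1), c (k + j)
      ≤ ∑ j ∈ Finset.range γ, ∑ i ∈ Finset.range (M + γ), c i := by
        refine Finset.sum_le_sum fun j hj => ?_
        rw [← Finset.sum_image (s := Finset.range (M + 1)) (g := fun k => k + j) (f := c)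
          (by intro x _ y _ hxy; simpa using hxy)]
        refine Finset.sum_le_sum_of_subset_of_nonneg ?_ fun _ _ _ => hc _
        intro i hi
        simp only [Finset.mem_image, Finset.mem_range] at hi hj ⊢
        omega
    _ = γ * ∑ i ∈ Finset.range (M + γ), c i := by simp

/-- Splitting off the first window and summing a windowed recursion of nonnegative sequences. -/
theorem sum_le_of_window {A B C : ℕ → ℝ} {q : ℝ} (hq : 0 ≤ q) (hA : ∀ k, 0 ≤ A k)
    (hB : ∀ k, 0 ≤ B k) (hC : ∀ k, 0 ≤ C k)
    (h : ∀ k, A (k + γ) ≤ q * A k + C k + ∑ j ∈ Finset.range γ, B (k + j)) (N : ℕ) :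
    (1 - q) * ∑ k ∈ Finset.range (N + 1), A k ≤ ∑ k ∈ Finset.range γ, A k
      + ∑ k ∈ Finset.range (N + 1), C k + γ * ∑ k ∈ Finset.range N, B k := by
  have hsC : 0 ≤ ∑ k ∈ Finset.range (N + 1), C k := Finset.sum_nonneg fun k _ => hC k
  have hsB : 0 ≤ ∑ k ∈ Finset.range N, B k := Finset.sum_nonneg fun k _ => hB k
  have hsA : 0 ≤ ∑ k ∈ Finset.range (N + 1), A k := Finset.sum_nonneg fun k _ => hA k
  rcases lt_or_ge N γ with hN | hN
  · have h1 : ∑ k ∈ Finset.range (N + 1), A k ≤ ∑ k ∈ Finset.range γ, A k :=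
      Finset.sum_le_sum_of_subset_of_nonneg (Finset.range_mono hN) fun k _ _ => hA k
    have h2 : 0 ≤ (γ : ℝ) * ∑ k ∈ Finset.range N, B k := by positivity
    have h3 : 0 ≤ q * ∑ k ∈ Finset.range (N + 1), A k := by positivity
    linarith
  · obtain ⟨M, rfl⟩ := Nat.exists_eq_add_of_le' hN
    have h1 : ∑ k ∈ Finset.range (M + γ + 1), A k
        = ∑ k ∈ Finset.range γ, A k + ∑ k ∈ Finset.range (M + 1), A (k + γ) := by
      rw [show M + γ + 1 = γ + (M + 1) by ring, Finset.sum_range_add]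
      simp only [add_comm γ]
    have h2 : ∑ k ∈ Finset.range (M + 1), A (k + γ) ≤ q * ∑ k ∈ Finset.range (M + 1), A k
        + ∑ k ∈ Finset.range (M + 1), C k
        + ∑ k ∈ Finset.range (M + 1), ∑ j ∈ Finset.range γ, B (k + j) := by
      rw [Finset.mul_sum, ← Finset.sum_add_distrib, ← Finset.sum_add_distrib]
      exact Finset.sum_le_sum fun k _ => h k
    have h3 := sum_window_le γ M hB
    have h4 : ∑ k ∈ Finset.range (M + 1), A k ≤ ∑ k ∈ Finset.range (M + γ + 1), A k :=
      Finset.sum_le_sum_of_subset_of_nonneg (Finset.range_mono (by omega)) fun k _ _ => hA k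
    have h5 : ∑ k ∈ Finset.range (M + 1), C k ≤ ∑ k ∈ Finset.range (M + γ + 1), C k :=
      Finset.sum_le_sum_of_subset_of_nonneg (Finset.range_mono (by omega)) fun k _ _ => hC k
    have h6 := mul_le_mul_of_nonneg_left h4 hq
    linarith

theorem IsWindowContraction.sum_sq_le (h : IsWindowContraction γ σ a b) (hσ0 : 0 ≤ σ)
    (hσ1 : σ < 1) (N : ℕ) :
    ∑ k ∈ Finset.range (N + 1), a k ^ 2 ≤ (1 / (1 - σ)) * ∑ k ∈ Finset.range γ, a k ^ 2
      + (γ / (1 - σ)) ^ 2 * ∑ k ∈ Finset.range N, b k ^ 2 := by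
  have hs : 0 < 1 - σ := by linarith
  have key := sum_le_of_window (γ := γ) (A := fun k => a k ^ 2)
    (B := fun k => γ / (1 - σ) * b k ^ 2) (C := fun _ => 0) hσ0 (fun k => sq_nonneg _)
    (fun k => by positivity) (fun k => le_rfl)
    (fun k => by rw [← Finset.mul_sum, add_zero]; exact h.sq_le hσ0 hσ1 k) N
  rw [← Finset.mul_sum, Finset.sum_const_zero, add_zero] at key
  have e : (1 / (1 - σ)) * ∑ k ∈ Finset.range γ, a k ^ 2
      + (γ / (1 - σ)) ^ 2 * ∑ k ∈ Finset.range N, b k ^ 2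
      = (∑ k ∈ Finset.range γ, a k ^ 2
        + γ * (γ / (1 - σ) * ∑ k ∈ Finset.range N, b k ^ 2)) / (1 - σ) := by
    field_simp
  rw [e, le_div_iff₀ hs]
  linarith

/-- A windowed recursion started at `0` amplifies square sums at most by `2 (γ / (1 - σ))²`. -/
theorem IsWindowContraction.sum_sq_le_of_zero (h : IsWindowContraction γ σ a b) (hγ : 1 ≤ γ)
    (hσ0 : 0 ≤ σ) (hσ1 : σ < 1) (ha0 : a 0 = 0) (N : ℕ) :
    ∑ k ∈ Finset.range (N + 1), a k ^ 2
      ≤ 2 * (γ / (1 - σ)) ^ 2 * ∑ k ∈ Finset.range N, b k ^ 2 := by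
  have hs : 0 < 1 - σ := by linarith
  have hsum : ∀ k, a k ≤ ∑ j ∈ Finset.range k, b j := by
    intro k
    induction k with
    | zero => simp [ha0]
    | succ k ih =>
      rw [Finset.sum_range_succ]
      linarith [h.step k]
  set B := ∑ k ∈ Finset.range N, b k ^ 2 with hB
  have hB0 : 0 ≤ B := Finset.sum_nonneg fun _ _ => sq_nonneg _
  have hsq : ∀ k ≤ N, k ≤ γ → a k ^ 2 ≤ γ * B := by
    intro k hkN hkγ
    have h1 : a k ^ 2 ≤ (∑ j ∈ Finset.range k, b j) ^ 2 :=
      pow_le_pow_left₀ (h.nonneg_left _) (hsum k) 2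
    have h2 : (∑ j ∈ Finset.range k, b j) ^ 2 ≤ k * ∑ j ∈ Finset.range k, b j ^ 2 := by
      simpa using sq_sum_le_card_mul_sum_sq (s := Finset.range k) (f := b)
    have h3 : ∑ j ∈ Finset.range k, b j ^ 2 ≤ B :=
      Finset.sum_le_sum_of_subset_of_nonneg (Finset.range_mono hkN) fun _ _ _ => sq_nonneg _
    calc a k ^ 2 ≤ k * ∑ j ∈ Finset.range k, b j ^ 2 := h1.trans h2
      _ ≤ γ * B := by gcongr
  have hinit : ∀ M ≤ N + 1, M ≤ γ → ∑ k ∈ Finset.range M, a k ^ 2 ≤ (γ : ℝ) ^ 2 * B := by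
    intro M hMN hMγ
    calc ∑ k ∈ Finset.range M, a k ^ 2 ≤ ∑ k ∈ Finset.range M, γ * B := by
          refine Finset.sum_le_sum fun k hk => ?_
          have := Finset.mem_range.1 hk
          exact hsq k (by omega) (by omega)
      _ = M * (γ * B) := by simp
      _ ≤ γ * (γ * B) := by gcongr
      _ = (γ : ℝ) ^ 2 * B := by ring
  have hinv : 1 ≤ 1 / (1 - σ) := by
    rw [le_div_iff₀ hs]
    linarith
  have hγτ : (γ : ℝ) ^ 2 * B ≤ (γ / (1 - σ)) ^ 2 * B := by
    have : (γ : ℝ) ≤ γ / (1 - σ) := by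
      rw [le_div_iff₀ hs]
      have : (0 : ℝ) ≤ γ := by positivity
      nlinarith
    gcongr
  rcases lt_or_ge N γ with hN | hN
  · have h1 := hinit (N + 1) le_rfl hN
    have h2 : 0 ≤ (γ / (1 - σ)) ^ 2 * B := by positivity
    linarith
  · have h1 := hinit γ (by omega) le_rfl
    have h2 := h.sum_sq_le hσ0 hσ1 N
    have h3 : (1 / (1 - σ)) * ∑ k ∈ Finset.range γ, a k ^ 2 ≤ (γ / (1 - σ)) ^ 2 * B := by
      calc (1 / (1 - σ)) * ∑ k ∈ Finset.range γ, a k ^ 2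
          ≤ (1 / (1 - σ)) * ((1 / (1 - σ)) * ((γ : ℝ) ^ 2 * B)) := by
            gcongr
            have : 0 ≤ (γ : ℝ) ^ 2 * B := by positivity
            nlinarith
        _ = (γ / (1 - σ)) ^ 2 * B := by
            field_simp
    linarith

/-- Square sums with the growing weights `t k ^ 2`. Since `t (k + γ) ≤ t k + γ`, the weights change
little over a window once `t k` exceeds `γ / (1 - σ)`; before that, the growth is paid for by the
unweighted bound, at the price of one more factor `(γ / (1 - σ))²`. -/
theorem IsWindowContraction.sum_weighted_sq_le (h : IsWindowContraction γ σ a b) (hγ : 1 ≤ γ)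
    (hσ0 : 0 ≤ σ) (hσ1 : σ < 1) {t : ℕ → ℝ} (ht0 : t 0 = 1) (ht1 : ∀ k, 1 ≤ t k)
    (ht : ∀ k, t (k + 1) ≤ t k + 1) {M : ℝ} (hM : ∀ k < γ, a k ^ 2 ≤ M) (N : ℕ) :
    ∑ k ∈ Finset.range (N + 1), t k ^ 2 * a k ^ 2
      ≤ 8 * (γ / (1 - σ)) ^ 3 * M
        + 14 * (γ / (1 - σ)) ^ 4 * ∑ k ∈ Finset.range N, t k ^ 2 * b k ^ 2 := by
  set s := 1 - σ with hs_def
  have hs : 0 < s := by linarith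
  have hs1 : s ≤ 1 := by linarith
  have hγ1 : (1 : ℝ) ≤ γ := by exact_mod_cast hγ
  set τ := (γ : ℝ) / s with hτ_def
  have hγτ : (γ : ℝ) = τ * s := by
    rw [hτ_def]
    field_simp
  have hτ : 0 < τ := by positivity
  have ht_add : ∀ k j, t (k + j) ≤ t k + j := by
    intro k j
    induction j with
    | zero => simp
    | succ j ih =>
      have := ht (k + j)
      rw [← add_assoc]
      push_cast
      linarith
  have hM0 : 0 ≤ M := (sq_nonneg _).trans (hM 0 hγ)
  set G := ∑ k ∈ Finset.range N, t k ^ 2 * b k ^ 2 with hG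
  have hBG : ∑ k ∈ Finset.range N, b k ^ 2 ≤ G := by
    refine Finset.sum_le_sum fun k _ => ?_
    have : 1 ≤ t k ^ 2 := one_le_pow₀ (ht1 k)
    exact le_mul_of_one_le_left (sq_nonneg _) this
  have hG0 : 0 ≤ G := (Finset.sum_nonneg fun _ _ => sq_nonneg _).trans hBG
  -- `(t + γ)² ≤ (1 + s / 2) t² + (1 + 2 / s) γ²` keeps the contraction factor below `(1 + σ) / 2`.
  have hstep : ∀ k, t (k + γ) ^ 2 * a (k + γ) ^ 2 ≤ (1 + σ) / 2 * (t k ^ 2 * a k ^ 2)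
      + 3 * (γ : ℝ) ^ 2 / s * a k ^ 2
      + ∑ j ∈ Finset.range γ, 4 * (γ : ℝ) ^ 2 * τ * (t (k + j) ^ 2 * b (k + j) ^ 2) := by
    intro k
    have hpos : 0 ≤ t (k + γ) := zero_le_one.trans (ht1 _)
    have h1 : t (k + γ) ^ 2 * a (k + γ) ^ 2 ≤ t (k + γ) ^ 2 * (σ * a k ^ 2)
        + ∑ j ∈ Finset.range γ, τ * (t (k + γ) ^ 2 * b (k + j) ^ 2) := by
      have := mul_le_mul_of_nonneg_left (h.sq_le hσ0 hσ1 k) (sq_nonneg (t (k + γ)))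
      rw [← Finset.mul_sum, ← Finset.mul_sum]
      rw [← hs_def, ← hτ_def] at this
      linarith
    have h2 : t (k + γ) ^ 2 * (σ * a k ^ 2) ≤ (1 + σ) / 2 * (t k ^ 2 * a k ^ 2)
        + 3 * (γ : ℝ) ^ 2 / s * a k ^ 2 := by
      have e1 : t (k + γ) ^ 2 ≤ (t k + γ) ^ 2 := pow_le_pow_left₀ hpos (ht_add k γ) 2
      have e2 : σ * (t k + γ) ^ 2 ≤ (1 + σ) / 2 * t k ^ 2 + 3 * (γ : ℝ) ^ 2 / s := by
        have e3 : (t k + γ) ^ 2 ≤ (1 + s / 2) * t k ^ 2 + (1 + 2 / s) * (γ : ℝ) ^ 2 := by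
          have : (1 + s / 2) * t k ^ 2 + (1 + 2 / s) * (γ : ℝ) ^ 2 - (t k + γ) ^ 2
              = (s * t k - 2 * γ) ^ 2 / (2 * s) := by
            field_simp
            ring
          have : 0 ≤ (s * t k - 2 * γ) ^ 2 / (2 * s) := by positivity
          linarith
        have e4 : σ * (1 + s / 2) ≤ (1 + σ) / 2 := by
          rw [hs_def]
          nlinarith
        have e5 : σ * (1 + 2 / s) ≤ 3 / s := by
          rw [le_div_iff₀ hs]
          have : σ * (1 + 2 / s) * s = σ * (s + 2) := by field_simp
          rw [this, hs_def]
          nlinarith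
        calc σ * (t k + γ) ^ 2
            ≤ σ * ((1 + s / 2) * t k ^ 2 + (1 + 2 / s) * (γ : ℝ) ^ 2) := by gcongr
          _ = σ * (1 + s / 2) * t k ^ 2 + σ * (1 + 2 / s) * (γ : ℝ) ^ 2 := by ring
          _ ≤ (1 + σ) / 2 * t k ^ 2 + 3 / s * (γ : ℝ) ^ 2 := by gcongr
          _ = (1 + σ) / 2 * t k ^ 2 + 3 * (γ : ℝ) ^ 2 / s := by ring
      calc t (k + γ) ^ 2 * (σ * a k ^ 2) ≤ (t k + γ) ^ 2 * (σ * a k ^ 2) := by gcongr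
        _ = σ * (t k + γ) ^ 2 * a k ^ 2 := by ring
        _ ≤ ((1 + σ) / 2 * t k ^ 2 + 3 * (γ : ℝ) ^ 2 / s) * a k ^ 2 := by gcongr
        _ = _ := by ring
    have h3 : ∑ j ∈ Finset.range γ, τ * (t (k + γ) ^ 2 * b (k + j) ^ 2)
        ≤ ∑ j ∈ Finset.range γ, 4 * (γ : ℝ) ^ 2 * τ * (t (k + j) ^ 2 * b (k + j) ^ 2) := by
      refine Finset.sum_le_sum fun j hj => ?_
      have hj' := (Finset.mem_range.1 hj).le
      have e1 : t (k + γ) ≤ 2 * γ * t (k + j) := by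
        have := ht_add (k + j) (γ - j)
        rw [show k + j + (γ - j) = k + γ by omega, Nat.cast_sub hj'] at this
        have e2 := ht1 (k + j)
        have e3 : (0 : ℝ) ≤ j := by positivity
        nlinarith
      have e4 : t (k + γ) ^ 2 ≤ (2 * γ * t (k + j)) ^ 2 := pow_le_pow_left₀ hpos e1 2
      calc τ * (t (k + γ) ^ 2 * b (k + j) ^ 2)
          ≤ τ * ((2 * γ * t (k + j)) ^ 2 * b (k + j) ^ 2) := by gcongr
        _ = _ := by ring
    linarith
  have key := sum_le_of_window (γ := γ) (A := fun k => t k ^ 2 * a k ^ 2)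
    (B := fun k => 4 * (γ : ℝ) ^ 2 * τ * (t k ^ 2 * b k ^ 2))
    (C := fun k => 3 * (γ : ℝ) ^ 2 / s * a k ^ 2) (q := (1 + σ) / 2) (by linarith)
    (fun k => by positivity) (fun k => by positivity) (fun k => by positivity) hstep N
  rw [← Finset.mul_sum, ← Finset.mul_sum, ← hG] at key
  have hA0 : ∑ k ∈ Finset.range γ, a k ^ 2 ≤ γ * M := by
    calc ∑ k ∈ Finset.range γ, a k ^ 2 ≤ ∑ k ∈ Finset.range γ, M :=
          Finset.sum_le_sum fun k hk => hM k (Finset.mem_range.1 hk)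
      _ = γ * M := by simp
  have hA1 : ∑ k ∈ Finset.range γ, t k ^ 2 * a k ^ 2 ≤ (γ : ℝ) ^ 3 * M := by
    calc ∑ k ∈ Finset.range γ, t k ^ 2 * a k ^ 2 ≤ ∑ k ∈ Finset.range γ, (γ : ℝ) ^ 2 * M := by
          refine Finset.sum_le_sum fun k hk => ?_
          have hk' : ((k + 1 : ℕ) : ℝ) ≤ γ := by exact_mod_cast Finset.mem_range.1 hk
          have e1 := ht_add 0 k
          rw [zero_add, ht0] at e1
          push_cast at hk'
          have e2 : t k ≤ γ := by linarith
          have e3 : 0 ≤ t k := zero_le_one.trans (ht1 _)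
          have e4 := hM k (Finset.mem_range.1 hk)
          gcongr
      _ = (γ : ℝ) ^ 3 * M := by
          simp
          ring
  have hA2 : ∑ k ∈ Finset.range (N + 1), a k ^ 2 ≤ τ * M + τ ^ 2 * G := by
    refine (h.sum_sq_le hσ0 hσ1 N).trans ?_
    rw [← hs_def, ← hτ_def]
    have : (1 / s) * ∑ k ∈ Finset.range γ, a k ^ 2 ≤ τ * M := by
      calc (1 / s) * ∑ k ∈ Finset.range γ, a k ^ 2 ≤ (1 / s) * (γ * M) := by gcongr
        _ = τ * M := by rw [hτ_def]; ring
    gcongr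
  set S := ∑ k ∈ Finset.range (N + 1), t k ^ 2 * a k ^ 2 with hS
  have h4 : 3 * (γ : ℝ) ^ 2 / s * ∑ k ∈ Finset.range (N + 1), a k ^ 2
      ≤ 3 * (γ : ℝ) ^ 2 / s * (τ * M + τ ^ 2 * G) := by gcongr
  have h5 : s / 2 * S ≤ s / 2 * (2 * s ^ 2 * (τ ^ 3 * M) + 6 * (τ ^ 3 * M) + 6 * (τ ^ 4 * G)
      + 8 * s ^ 2 * (τ ^ 4 * G)) := by
    have e1 : 3 * (γ : ℝ) ^ 2 / s = 3 * τ ^ 2 * s := by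
      rw [hγτ]
      field_simp
    rw [e1] at h4 key
    rw [hγτ] at hA1 key
    have e2 : 1 - (1 + σ) / 2 = s / 2 := by
      rw [hs_def]
      ring
    rw [e2] at key
    linarith
  have h6 := le_of_mul_le_mul_left h5 (by positivity)
  have h7 : s ^ 2 ≤ 1 := pow_le_one₀ hs.le hs1
  have h8 : s ^ 2 * (τ ^ 3 * M) ≤ τ ^ 3 * M := mul_le_of_le_one_left (by positivity) h7
  have h9 : s ^ 2 * (τ ^ 4 * G) ≤ τ ^ 4 * G := mul_le_of_le_one_left (by positivity) h7
  linarith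

end Scalar

/-! ### Doubly stochastic mixing -/

section Mixing

variable {m n : ℕ}

theorem mem_doublyStochastic_of_timeVaryingWeights {γ : ℕ} {E : ℕ → Set (Fin m × Fin m)}
    {W : ℕ → Matrix (Fin m) (Fin m) ℝ} (hW : TimeVaryingWeights E W γ) (k : ℕ) :
    W k ∈ doublyStochastic ℝ (Fin m) := by
  rw [mem_doublyStochastic_iff_sum]
  refine ⟨fun i j => ?_, hW.row_sum k, hW.col_sum k⟩
  by_cases h : (i, j) ∈ E k ∨ i = j
  · exact ((hW.pos_iff k i j).2 h).le
  · exact (hW.eq_zero k i j h).ge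

theorem windowProd_mem_doublyStochastic {W : ℕ → Matrix (Fin m) (Fin m) ℝ}
    (hW : ∀ k, W k ∈ doublyStochastic ℝ (Fin m)) (a t : ℕ) :
    windowProd W a t ∈ doublyStochastic ℝ (Fin m) := by
  induction t with
  | zero => exact one_mem _
  | succ t ih => exact mul_mem (hW _) ih

theorem avgMatrix_mem_doublyStochastic (hm : 1 ≤ m) :
    avgMatrix m ∈ doublyStochastic ℝ (Fin m) := by
  have : (m : ℝ) ≠ 0 := by positivity
  rw [mem_doublyStochastic_iff_sum]
  refine ⟨fun i j => ?_, fun i => ?_, fun j => ?_⟩ <;> simp [avgMatrix, this]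

/-- A doubly stochastic matrix does not increase the sum of squares, by Jensen's inequality along
the rows and summation over the columns. -/
theorem sum_sq_doublyStochastic_le {W : Matrix (Fin m) (Fin m) ℝ}
    (hW : W ∈ doublyStochastic ℝ (Fin m)) (v : Fin m → ℝ) :
    ∑ i, (∑ j, W i j * v j) ^ 2 ≤ ∑ j, v j ^ 2 := by
  obtain ⟨h0, hr, hc⟩ := mem_doublyStochastic_iff_sum.1 hW
  have h1 : ∀ i, (∑ j, W i j * v j) ^ 2 ≤ ∑ j, W i j * v j ^ 2 := by
    intro i
    have := Finset.sum_sq_le_sum_mul_sum_of_sq_le_mul Finset.univ (r := fun j => W i j * v j)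
      (f := fun j => W i j) (g := fun j => W i j * v j ^ 2) (fun j _ => h0 i j)
      (fun j _ => mul_nonneg (h0 i j) (sq_nonneg _)) (fun j _ => le_of_eq (by ring))
    rwa [hr i, one_mul] at this
  calc ∑ i, (∑ j, W i j * v j) ^ 2 ≤ ∑ i, ∑ j, W i j * v j ^ 2 := Finset.sum_le_sum fun i _ => h1 i
    _ = ∑ j, v j ^ 2 := by
      rw [Finset.sum_comm]
      simp only [← Finset.sum_mul, hc, one_mul]

theorem frobNorm_mix_le {W : Matrix (Fin m) (Fin m) ℝ} (hW : W ∈ doublyStochastic ℝ (Fin m))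
    (X : Agg m n) : frobNorm (mix W X) ≤ frobNorm X := by
  refine Real.sqrt_le_sqrt ((Finset.sum_le_sum fun i _ => ?_).trans
    (sum_sq_doublyStochastic_le hW fun j => ‖X j‖))
  refine pow_le_pow_left₀ (norm_nonneg _) ((norm_sum_le _ _).trans_eq ?_) 2
  refine Finset.sum_congr rfl fun j _ => ?_
  rw [norm_smul, Real.norm_of_nonneg (nonneg_of_mem_doublyStochastic hW)]

theorem spectralNorm_doublyStochastic_le {W : Matrix (Fin m) (Fin m) ℝ}
    (hW : W ∈ doublyStochastic ℝ (Fin m)) : spectralNorm W ≤ 1 := by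
  refine ContinuousLinearMap.opNorm_le_bound _ zero_le_one fun v => ?_
  rw [one_mul, EuclideanSpace.norm_eq, EuclideanSpace.norm_eq]
  refine Real.sqrt_le_sqrt ?_
  simpa [Matrix.mulVec, dotProduct] using sum_sq_doublyStochastic_le hW v.ofLp

theorem spectralNorm_windowProd_le_jointSigma (hm : 1 ≤ m) {W : ℕ → Matrix (Fin m) (Fin m) ℝ}
    (hW : ∀ k, W k ∈ doublyStochastic ℝ (Fin m)) (γ a : ℕ) :
    spectralNorm (windowProd W a γ - avgMatrix m) ≤ jointSigma W γ := by
  refine le_ciSup (f := fun a => spectralNorm (windowProd W a γ - avgMatrix m)) ⟨2, ?_⟩ a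
  rintro _ ⟨b, rfl⟩
  have h1 := spectralNorm_doublyStochastic_le (windowProd_mem_doublyStochastic hW b γ)
  have h2 := spectralNorm_doublyStochastic_le (avgMatrix_mem_doublyStochastic hm)
  simp only [spectralNorm, map_sub] at *
  exact (norm_sub_le _ _).trans (by linarith)

theorem jointSigma_nonneg (W : ℕ → Matrix (Fin m) (Fin m) ℝ) (γ : ℕ) : 0 ≤ jointSigma W γ :=
  Real.iSup_nonneg fun _ => norm_nonneg _

/-- The spectral norm bounds the action on an aggregate variable, column by column. -/
theorem frobNorm_mix_le_spectralNorm_mul (A : Matrix (Fin m) (Fin m) ℝ) (X : Agg m n) :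
    frobNorm (mix A X) ≤ spectralNorm A * frobNorm X := by
  have hA : 0 ≤ spectralNorm A := norm_nonneg _
  have hcol : ∀ Y : Agg m n, frobSq Y = ∑ l, ‖WithLp.toLp 2 (fun i => Y i l)‖ ^ 2 := by
    intro Y
    simp only [frobSq, EuclideanSpace.norm_sq_eq]
    exact Finset.sum_comm
  refine Real.sqrt_le_iff.2 ⟨mul_nonneg hA (frobNorm_nonneg X), ?_⟩
  rw [mul_pow, frobNorm_sq, hcol, hcol, Finset.mul_sum]
  refine Finset.sum_le_sum fun l _ => ?_
  rw [← mul_pow]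
  refine pow_le_pow_left₀ (norm_nonneg _) ?_ 2
  have h := (Matrix.toEuclideanCLM (n := Fin m) (𝕜 := ℝ) A).le_opNorm
    (WithLp.toLp 2 (fun i => X i l))
  have e : Matrix.toEuclideanCLM (n := Fin m) (𝕜 := ℝ) A (WithLp.toLp 2 (fun i => X i l))
      = WithLp.toLp 2 (fun i => mix A X i l) := by
    ext i
    simp [mix, Matrix.mulVec, dotProduct]
  rwa [e] at h

theorem mix_mul (A B : Matrix (Fin m) (Fin m) ℝ) (X : Agg m n) :
    mix (A * B) X = mix A (mix B X) := by
  funext i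
  simp only [mix, Matrix.mul_apply, Finset.smul_sum, Finset.sum_smul, smul_smul]
  exact Finset.sum_comm

theorem mix_sub_avgMatrix (A : Matrix (Fin m) (Fin m) ℝ) {X : Agg m n} (hX : avg X = 0) :
    mix (A - avgMatrix m) X = mix A X := by
  funext i
  have : ∑ j, avgMatrix m i j • X j = 0 := by
    simpa [avgMatrix, avg, Finset.smul_sum] using hX
  simp [mix, sub_smul, this]

theorem mix_add (A : Matrix (Fin m) (Fin m) ℝ) (X Y : Agg m n) :
    mix A (X + Y) = mix A X + mix A Y := by
  funext i
  simp [mix, Finset.sum_add_distrib]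

theorem mix_smul (A : Matrix (Fin m) (Fin m) ℝ) (c : ℝ) (X : Agg m n) :
    mix A (c • X) = c • mix A X := by
  funext i
  simp only [mix, Pi.smul_apply, Finset.smul_sum]
  exact Finset.sum_congr rfl fun j _ => smul_comm _ _ _

theorem windowProd_shift (W : ℕ → Matrix (Fin m) (Fin m) ℝ) (a t : ℕ) :
    windowProd (fun k => W (k + 1)) a t = windowProd W (a + 1) t := by
  induction t with
  | zero => rfl
  | succ t ih => simp only [windowProd, ih, add_right_comm a t 1]

/-- A mean-zero aggregate variable driven by (possibly damped) doubly stochastic mixing is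
contracted by the spectral gap of each window, up to the accumulated perturbations. -/
theorem isWindowContraction_of_mix {γ : ℕ} {σ : ℝ} {W : ℕ → Matrix (Fin m) (Fin m) ℝ}
    (hW : ∀ k, W k ∈ doublyStochastic ℝ (Fin m))
    (hσ : ∀ a, spectralNorm (windowProd W a γ - avgMatrix m) ≤ σ)
    {ρ : ℕ → ℝ} (hρ0 : ∀ k, 0 ≤ ρ k) (hρ1 : ∀ k, ρ k ≤ 1) {p q : ℕ → Agg m n}
    (hp : ∀ k, avg (p k) = 0) (hpq : ∀ k, p (k + 1) = ρ k • mix (W k) (p k) + q k) :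
    IsWindowContraction γ σ (fun k => frobNorm (p k)) (fun k => frobNorm (q k)) := by
  have hdamp : ∀ k (X : Agg m n), frobNorm (ρ k • mix (W k) X) ≤ frobNorm X := by
    intro k X
    rw [frobNorm_smul, abs_of_nonneg (hρ0 k)]
    exact (mul_le_of_le_one_left (frobNorm_nonneg _) (hρ1 k)).trans (frobNorm_mix_le (hW k) X)
  refine ⟨fun k => frobNorm_nonneg _, fun k => frobNorm_nonneg _, fun k => ?_, fun k => ?_⟩
  · simp only [hpq k]
    exact (frobNorm_add_le _ _).trans (add_le_add (hdamp k _) le_rfl)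
  · have hrem : ∀ t, ∃ (c : ℝ) (R : Agg m n), 0 ≤ c ∧ c ≤ 1 ∧
        p (k + t) = c • mix (windowProd W k t) (p k) + R ∧
        frobNorm R ≤ ∑ j ∈ Finset.range t, frobNorm (q (k + j)) := by
      intro t
      induction t with
      | zero =>
        refine ⟨1, 0, zero_le_one, le_rfl, ?_, ?_⟩
        · funext i
          simp [mix, windowProd, Matrix.one_apply]
        · simp [frobNorm, frobSq]
      | succ t ih =>
        obtain ⟨c, R, hc0, hc1, hR, hRn⟩ := ih
        refine ⟨ρ (k + t) * c, ρ (k + t) • mix (W (k + t)) R + q (k + t),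
          mul_nonneg (hρ0 _) hc0, mul_le_one₀ (hρ1 _) hc0 hc1, ?_, ?_⟩
        · rw [← add_assoc, hpq, hR, mix_add, mix_smul, smul_add, smul_smul, windowProd, mix_mul]
          abel
        · rw [Finset.sum_range_succ]
          exact (frobNorm_add_le _ _).trans (add_le_add ((hdamp _ _).trans hRn) le_rfl)
    obtain ⟨c, R, hc0, hc1, hR, hRn⟩ := hrem γ
    have h1 : frobNorm (mix (windowProd W k γ) (p k)) ≤ σ * frobNorm (p k) := by
      rw [← mix_sub_avgMatrix _ (hp k)]
      exact (frobNorm_mix_le_spectralNorm_mul _ _).trans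
        (mul_le_mul_of_nonneg_right (hσ k) (frobNorm_nonneg _))
    have h2 : frobNorm (c • mix (windowProd W k γ) (p k)) ≤ σ * frobNorm (p k) := by
      rw [frobNorm_smul, abs_of_nonneg hc0]
      exact (mul_le_of_le_one_left (frobNorm_nonneg _) hc1).trans h1
    simp only [hR]
    exact (frobNorm_add_le _ _).trans (add_le_add h2 hRn)

end Mixing

/-! ### Nesterov's parameters -/

section Nesterov

variable {θ : ℕ → ℝ}

/-- The previous inverse parameter `1 / θ (k - 1)`, set to `0` at `k = 0`. With this value the
defining relation of the parameters, `inv_theta_sq_mul` below, holds from `k = 0` on. -/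
noncomputable def prevInv (θ : ℕ → ℝ) : ℕ → ℝ
  | 0 => 0
  | k + 1 => 1 / θ k

theorem IsNesterovSeq.le_one (hθ : IsNesterovSeq θ) (k : ℕ) : θ k ≤ 1 := by
  cases k with
  | zero => exact hθ.zero.le
  | succ k =>
    have h1 := hθ.step k
    have h2 : 0 < 1 / θ k ^ 2 := by
      have := hθ.pos k
      positivity
    have h3 : 0 < θ (k + 1) ^ 2 := pow_pos (hθ.pos _) 2
    rw [← h1, div_pos_iff_of_pos_right h3] at h2
    linarith

theorem IsNesterovSeq.inv_theta_sq_mul (hθ : IsNesterovSeq θ) (k : ℕ) :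
    (1 / θ k) ^ 2 * (1 - θ k) = prevInv θ k ^ 2 := by
  cases k with
  | zero => simp [prevInv, hθ.zero]
  | succ k =>
    have h := hθ.step k
    simp only [prevInv, div_pow, one_pow]
    rw [← h]
    ring

theorem IsNesterovSeq.one_le_inv (hθ : IsNesterovSeq θ) (k : ℕ) : 1 ≤ 1 / θ k :=
  (one_le_div (hθ.pos k)).2 (hθ.le_one k)

theorem IsNesterovSeq.inv_sq_sub (hθ : IsNesterovSeq θ) (k : ℕ) :
    (1 / θ (k + 1)) ^ 2 - 1 / θ (k + 1) = (1 / θ k) ^ 2 := by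
  have h := hθ.inv_theta_sq_mul (k + 1)
  have h0 := (hθ.pos (k + 1)).ne'
  rw [show prevInv θ (k + 1) = 1 / θ k from rfl] at h
  rw [← h]
  field_simp

theorem IsNesterovSeq.inv_succ_le (hθ : IsNesterovSeq θ) (k : ℕ) :
    1 / θ (k + 1) ≤ 1 / θ k + 1 := by
  have h := hθ.inv_sq_sub k
  have h1 := hθ.one_le_inv k
  by_contra! hlt
  nlinarith

theorem IsNesterovSeq.half_le_inv (hθ : IsNesterovSeq θ) (k : ℕ) :
    ((k : ℝ) + 2) / 2 ≤ 1 / θ k := by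
  induction k with
  | zero => simp [hθ.zero]
  | succ k ih =>
    have h := hθ.inv_sq_sub k
    have h1 := hθ.one_le_inv (k + 1)
    have h2 : 1 / θ k + 1 / 2 ≤ 1 / θ (k + 1) := by
      by_contra! hlt
      nlinarith [hθ.one_le_inv k]
    push_cast
    linarith

theorem IsNesterovSeq.prevInv_nonneg (hθ : IsNesterovSeq θ) (k : ℕ) : 0 ≤ prevInv θ k := by
  cases k with
  | zero => exact le_rfl
  | succ k => exact zero_le_one.trans (hθ.one_le_inv k)

theorem IsNesterovSeq.ratio_nonneg (hθ : IsNesterovSeq θ) (k : ℕ) : 0 ≤ θ k * prevInv θ k :=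
  mul_nonneg (hθ.pos k).le (hθ.prevInv_nonneg k)

theorem IsNesterovSeq.ratio_le_one (hθ : IsNesterovSeq θ) (k : ℕ) : θ k * prevInv θ k ≤ 1 := by
  have h := hθ.inv_theta_sq_mul k
  have h0 := hθ.pos k
  refine (sq_le_one_iff₀ (hθ.ratio_nonneg k)).1 ?_
  rw [mul_pow, ← h]
  have : θ k ^ 2 * ((1 / θ k) ^ 2 * (1 - θ k)) = 1 - θ k := by field_simp
  linarith

/-- The weight of the previous iterate after rescaling by `1 / θ k`, in terms of the ratio
`θ k / θ (k - 1)` of consecutive parameters. -/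
theorem IsNesterovSeq.inv_mul_one_sub (hθ : IsNesterovSeq θ) (k : ℕ) :
    1 / θ k * (1 - θ k) = θ k * prevInv θ k * prevInv θ k := by
  have h := hθ.inv_theta_sq_mul k
  have h0 := hθ.pos k
  rw [mul_assoc, ← sq, ← h]
  field_simp

end Nesterov

/-! ### One accelerated step with inexact gradients -/

section Descent

variable {m n : ℕ} {L : ℝ} {f : Fin m → EuclideanSpace ℝ (Fin n) → ℝ}

/-- The value at `w` of the averaged linearization of the local functions, each linearized at its
own point `Y i`. -/
noncomputable def linearization (f : Fin m → EuclideanSpace ℝ (Fin n) → ℝ) (Y : Agg m n)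
    (w : EuclideanSpace ℝ (Fin n)) : ℝ :=
  (1 / (m : ℝ)) * ∑ i, (f i (Y i) + inner ℝ (gradient (f i) (Y i)) (w - Y i))

/-- The averaged Bregman divergence of `w` from the local points `Y i`. -/
noncomputable def bregman (f : Fin m → EuclideanSpace ℝ (Fin n) → ℝ) (Y : Agg m n)
    (w : EuclideanSpace ℝ (Fin n)) : ℝ :=
  objective f w - linearization f Y w

theorem linearization_eq_add_inner (Y : Agg m n) (w w' : EuclideanSpace ℝ (Fin n)) :
    linearization f Y w = linearization f Y w' + inner ℝ (avg (aggGrad f Y)) (w - w') := by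
  have h : inner ℝ (avg (aggGrad f Y)) (w - w')
      = (1 / (m : ℝ)) * ∑ i, inner ℝ (gradient (f i) (Y i)) (w - w') := by
    rw [avg, real_inner_smul_left, sum_inner]
    rfl
  rw [h, linearization, linearization, ← mul_add, ← Finset.sum_add_distrib]
  congr 1
  refine Finset.sum_congr rfl fun i _ => ?_
  rw [add_assoc, ← inner_add_right]
  congr 2
  abel

theorem bregman_eq (Y : Agg m n) (w : EuclideanSpace ℝ (Fin n)) :
    bregman f Y w = (1 / (m : ℝ)) *
      ∑ i, (f i w - f i (Y i) - inner ℝ (gradient (f i) (Y i)) (w - Y i)) := by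
  rw [bregman, objective, linearization, ← mul_sub, ← Finset.sum_sub_distrib]
  simp only [sub_sub]

theorem bregman_nonneg (hf : ∀ i, StronglyConvexSmooth 0 L (f i)) (Y : Agg m n)
    (w : EuclideanSpace ℝ (Fin n)) : 0 ≤ bregman f Y w := by
  rw [bregman_eq]
  refine mul_nonneg (by positivity) (Finset.sum_nonneg fun i _ => ?_)
  linarith [(hf i).gradient_ineq (Y i) w]

theorem sum_sq_gradient_sub_le (hm : 1 ≤ m) (hL : 0 < L)
    (hf : ∀ i, StronglyConvexSmooth 0 L (f i)) (Y : Agg m n) (w : EuclideanSpace ℝ (Fin n)) :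
    ∑ i, ‖gradient (f i) w - gradient (f i) (Y i)‖ ^ 2 ≤ 4 * L * m * bregman f Y w := by
  have hm0 : (m : ℝ) ≠ 0 := by positivity
  rw [bregman_eq, mul_assoc (4 * L), ← mul_assoc (m : ℝ), mul_one_div_cancel hm0, one_mul,
    Finset.mul_sum]
  exact Finset.sum_le_sum fun i _ => (hf i).sq_gradient_sub_le hL (Y i) w

theorem objective_le_linearization (hm : 1 ≤ m) (hf : ∀ i, StronglyConvexSmooth 0 L (f i))
    (Y : Agg m n) (w : EuclideanSpace ℝ (Fin n)) :
    objective f w ≤ linearization f Y w + L * ‖w - avg Y‖ ^ 2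
      + L / m * frobSq (consensusErr Y) := by
  have hm0 : (m : ℝ) ≠ 0 := by positivity
  have h : linearization f Y w + L * ‖w - avg Y‖ ^ 2 + L / m * frobSq (consensusErr Y)
      = (1 / (m : ℝ)) * ∑ i, (f i (Y i) + inner ℝ (gradient (f i) (Y i)) (w - Y i)
        + L * ‖w - Y i‖ ^ 2) := by
    rw [Finset.sum_add_distrib, ← Finset.mul_sum, sum_sq_dist hm, linearization]
    field_simp
    ring
  rw [h, objective]
  refine mul_le_mul_of_nonneg_left (Finset.sum_le_sum fun i _ => ?_) (by positivity)
  exact (hf i).le_add_sq (Y i) w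

/-- One step of Nesterov's method in which the averaged gradient is taken at the local points `Y i`
instead of their average; the price is the consensus error of `Y`. -/
theorem accelerated_step (hm : 1 ≤ m) (hf : ∀ i, StronglyConvexSmooth 0 L (f i)) {θ α : ℝ}
    (hθ0 : 0 < θ) (hα : 0 < α) {Y : Agg m n} {x z z' : EuclideanSpace ℝ (Fin n)}
    (hy : avg Y = θ • z + (1 - θ) • x) (hz : z' = z - (α / θ) • avg (aggGrad f Y))
    (w : EuclideanSpace ℝ (Fin n)) :
    objective f (θ • z' + (1 - θ) • x) - objective f w
      ≤ (1 - θ) * (objective f x - objective f w - bregman f Y x)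
        + θ ^ 2 / (2 * α) * (‖z - w‖ ^ 2 - ‖z' - w‖ ^ 2)
        - θ ^ 2 * (1 / (2 * α) - L) * ‖z' - z‖ ^ 2 + L / m * frobSq (consensusErr Y) := by
  set g := avg (aggGrad f Y) with hg
  have h1 := objective_le_linearization hm hf Y (θ • z' + (1 - θ) • x)
  have e1 : θ • z' + (1 - θ) • x - avg Y = θ • (z' - z) := by
    rw [hy, smul_sub]
    abel
  rw [e1, norm_smul, Real.norm_of_nonneg hθ0.le, mul_pow] at h1
  have h2 : linearization f Y (θ • z' + (1 - θ) • x)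
      = θ * linearization f Y z' + (1 - θ) * linearization f Y x := by
    have a1 := linearization_eq_add_inner (f := f) Y (θ • z' + (1 - θ) • x) 0
    have a2 := linearization_eq_add_inner (f := f) Y z' 0
    have a3 := linearization_eq_add_inner (f := f) Y x 0
    rw [sub_zero] at a1 a2 a3
    rw [a1, a2, a3, inner_add_right, real_inner_smul_right, real_inner_smul_right]
    ring
  have h3 := linearization_eq_add_inner (f := f) Y z' w
  have h4 : linearization f Y w ≤ objective f w := by
    have := bregman_nonneg hf Y w
    rw [bregman] at this
    linarith
  have h5 : inner ℝ g (z' - w) = θ / (2 * α) * (‖z - w‖ ^ 2 - ‖z' - w‖ ^ 2 - ‖z' - z‖ ^ 2) := by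
    have b1 : g = (θ / α) • (z - z') := by
      rw [hz, sub_sub_cancel, smul_smul]
      rw [show θ / α * (α / θ) = 1 by field_simp, one_smul]
    have b2 : ‖z - w‖ ^ 2 = ‖z' - z‖ ^ 2 + 2 * inner ℝ (z - z') (z' - w) + ‖z' - w‖ ^ 2 := by
      rw [norm_sub_rev z' z, ← norm_add_sq_real]
      congr 2
      abel
    rw [b1, real_inner_smul_left, b2]
    field_simp
    ring
  rw [← hg, h5] at h3
  have h6 : θ * linearization f Y z' ≤ θ * objective f w
      + θ * (θ / (2 * α) * (‖z - w‖ ^ 2 - ‖z' - w‖ ^ 2 - ‖z' - z‖ ^ 2)) := by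
    rw [h3, mul_add]
    gcongr
  have h7 : linearization f Y x = objective f x - bregman f Y x := by
    rw [bregman]
    ring
  rw [h2, h7] at h1
  have h8 : θ * (θ / (2 * α) * (‖z - w‖ ^ 2 - ‖z' - w‖ ^ 2 - ‖z' - z‖ ^ 2))
      = θ ^ 2 / (2 * α) * (‖z - w‖ ^ 2 - ‖z' - w‖ ^ 2) - θ ^ 2 * (1 / (2 * α)) * ‖z' - z‖ ^ 2 := by
    ring
  rw [h8] at h6
  linarith

end Descent

/-! ### The averaged iterates -/

section Iterates

variable {m n γ : ℕ} {L α : ℝ} {θ : ℕ → ℝ} {f : Fin m → EuclideanSpace ℝ (Fin n) → ℝ}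
  {E₁ E₂ E₃ : ℕ → Set (Fin m × Fin m)} {W₁ W₂ W₃ : ℕ → Matrix (Fin m) (Fin m) ℝ}
  {x y z s : ℕ → Agg m n}

theorem IsAccGradientTracking.step_z_convex (h : IsAccGradientTracking 0 α θ W₁ W₂ W₃ f x y z s)
    (k : ℕ) : z (k + 1) = mix (W₂ k) (z k) - (α / θ k) • s k := by
  simpa using h.step_z k

/-- Gradient tracking: the average of the trackers is the average of the local gradients. -/
theorem IsAccGradientTracking.avg_s (h : IsAccGradientTracking 0 α θ W₁ W₂ W₃ f x y z s)
    (hW₁ : TimeVaryingWeights E₁ W₁ γ) (k : ℕ) : avg (s k) = avg (aggGrad f (y k)) := by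
  induction k with
  | zero => rw [h.init_s]
  | succ k ih =>
    rw [h.step_s, avg_sub, avg_add, avg_mix (hW₁.col_sum _), ih]
    abel

theorem IsAccGradientTracking.avg_z (h : IsAccGradientTracking 0 α θ W₁ W₂ W₃ f x y z s)
    (hW₁ : TimeVaryingWeights E₁ W₁ γ) (hW₂ : TimeVaryingWeights E₂ W₂ γ) (k : ℕ) :
    avg (z (k + 1)) = avg (z k) - (α / θ k) • avg (aggGrad f (y k)) := by
  rw [h.step_z_convex, avg_sub, avg_smul, avg_mix (hW₂.col_sum _), h.avg_s hW₁]

theorem IsAccGradientTracking.avg_x (h : IsAccGradientTracking 0 α θ W₁ W₂ W₃ f x y z s)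
    (hW₃ : TimeVaryingWeights E₃ W₃ γ) (k : ℕ) :
    avg (x (k + 1)) = θ k • avg (z (k + 1)) + (1 - θ k) • avg (x k) := by
  rw [h.step_x, avg_add, avg_smul, avg_smul, avg_mix (hW₃.col_sum _)]

theorem IsAccGradientTracking.avg_y (h : IsAccGradientTracking 0 α θ W₁ W₂ W₃ f x y z s)
    (k : ℕ) : avg (y k) = θ k • avg (z k) + (1 - θ k) • avg (x k) := by
  rw [h.step_y, avg_add, avg_smul, avg_smul]

/-- The accelerated estimate summed over all steps. The terms gained on the left, the Bregman
divergences and the movements of `z`, pay for the consensus errors of `y` on the right. -/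
theorem IsAccGradientTracking.sum_descent (h : IsAccGradientTracking 0 α θ W₁ W₂ W₃ f x y z s)
    (hm : 1 ≤ m) (hf : ∀ i, StronglyConvexSmooth 0 L (f i))
    (hW₁ : TimeVaryingWeights E₁ W₁ γ) (hW₂ : TimeVaryingWeights E₂ W₂ γ)
    (hW₃ : TimeVaryingWeights E₃ W₃ γ) (hθ : IsNesterovSeq θ) (hα : 0 < α)
    (w : EuclideanSpace ℝ (Fin n)) (K : ℕ) :
    prevInv θ K ^ 2 * (objective f (avg (x K)) - objective f w)
        + 1 / (2 * α) * ‖avg (z K) - w‖ ^ 2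
        + ∑ k ∈ Finset.range K, prevInv θ k ^ 2 * bregman f (y k) (avg (x k))
        + (1 / (2 * α) - L) * ∑ k ∈ Finset.range K, ‖avg (z (k + 1)) - avg (z k)‖ ^ 2
      ≤ 1 / (2 * α) * ‖avg (z 0) - w‖ ^ 2
        + L / m * ∑ k ∈ Finset.range K, (1 / θ k) ^ 2 * frobSq (consensusErr (y k)) := by
  induction K with
  | zero => simp [prevInv]
  | succ K ih =>
    have h0 := hθ.pos K
    have h1 := accelerated_step hm hf h0 hα (h.avg_y K) (h.avg_z hW₁ hW₂ K) w
    rw [← h.avg_x hW₃ K] at h1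
    have h2 := mul_le_mul_of_nonneg_left h1 (sq_nonneg (1 / θ K))
    have e1 : (1 / θ K) ^ 2 * ((1 - θ K) * (objective f (avg (x K)) - objective f w
          - bregman f (y K) (avg (x K)))
        + θ K ^ 2 / (2 * α) * (‖avg (z K) - w‖ ^ 2 - ‖avg (z (K + 1)) - w‖ ^ 2)
        - θ K ^ 2 * (1 / (2 * α) - L) * ‖avg (z (K + 1)) - avg (z K)‖ ^ 2
        + L / m * frobSq (consensusErr (y K)))
        = prevInv θ K ^ 2 * (objective f (avg (x K)) - objective f w
          - bregman f (y K) (avg (x K)))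
        + 1 / (2 * α) * (‖avg (z K) - w‖ ^ 2 - ‖avg (z (K + 1)) - w‖ ^ 2)
        - (1 / (2 * α) - L) * ‖avg (z (K + 1)) - avg (z K)‖ ^ 2
        + L / m * ((1 / θ K) ^ 2 * frobSq (consensusErr (y K))) := by
      rw [← hθ.inv_theta_sq_mul K]
      field_simp
    rw [e1] at h2
    simp only [Finset.sum_range_succ]
    rw [show prevInv θ (K + 1) = 1 / θ K from rfl]
    linarith

/-! ### Consensus errors of the iterates -/

theorem IsAccGradientTracking.window_s (h : IsAccGradientTracking 0 α θ W₁ W₂ W₃ f x y z s)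
    (hm : 1 ≤ m) (hW₁ : TimeVaryingWeights E₁ W₁ γ) {σ : ℝ} (hσ : jointSigma W₁ γ ≤ σ) :
    IsWindowContraction γ σ (fun k => frobNorm (consensusErr (s k)))
      (fun k => frobNorm (consensusErr (aggGrad f (y (k + 1)) - aggGrad f (y k)))) := by
  have hd := mem_doublyStochastic_of_timeVaryingWeights hW₁
  refine isWindowContraction_of_mix (W := fun k => W₁ (k + 1)) (ρ := fun _ => 1)
    (fun k => hd _) (fun a => ?_) (fun _ => zero_le_one) (fun _ => le_rfl)
    (fun k => avg_consensusErr hm _) (fun k => ?_)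
  · rw [windowProd_shift]
    exact (spectralNorm_windowProd_le_jointSigma hm hd γ (a + 1)).trans hσ
  · rw [one_smul, ← consensusErr_mix (hW₁.row_sum _) (hW₁.col_sum _), ← consensusErr_add, h.step_s,
      add_sub_assoc]

theorem IsAccGradientTracking.window_z (h : IsAccGradientTracking 0 α θ W₁ W₂ W₃ f x y z s)
    (hm : 1 ≤ m) (hW₂ : TimeVaryingWeights E₂ W₂ γ) {σ : ℝ} (hσ : jointSigma W₂ γ ≤ σ) :
    IsWindowContraction γ σ (fun k => frobNorm (consensusErr (z k)))
      (fun k => frobNorm ((-(α / θ k)) • consensusErr (s k))) := by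
  have hd := mem_doublyStochastic_of_timeVaryingWeights hW₂
  refine isWindowContraction_of_mix (W := W₂) (ρ := fun _ => 1) hd
    (fun a => (spectralNorm_windowProd_le_jointSigma hm hd γ a).trans hσ)
    (fun _ => zero_le_one) (fun _ => le_rfl) (fun k => avg_consensusErr hm _) (fun k => ?_)
  rw [one_smul, ← consensusErr_mix (hW₂.row_sum _) (hW₂.col_sum _), ← consensusErr_smul,
    ← consensusErr_add, h.step_z_convex, neg_smul, sub_eq_add_neg]

/-- After division by the previous parameter, the consensus error of `x` obeys a mixing recursion
driven by that of `z`, damped by the ratio of consecutive parameters. -/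
theorem IsAccGradientTracking.window_x (h : IsAccGradientTracking 0 α θ W₁ W₂ W₃ f x y z s)
    (hm : 1 ≤ m) (hW₃ : TimeVaryingWeights E₃ W₃ γ) (hθ : IsNesterovSeq θ) {σ : ℝ}
    (hσ : jointSigma W₃ γ ≤ σ) :
    IsWindowContraction γ σ (fun k => frobNorm (prevInv θ k • consensusErr (x k)))
      (fun k => frobNorm (consensusErr (z (k + 1)))) := by
  have hd := mem_doublyStochastic_of_timeVaryingWeights hW₃
  refine isWindowContraction_of_mix (W := W₃) (ρ := fun k => θ k * prevInv θ k) hd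
    (fun a => (spectralNorm_windowProd_le_jointSigma hm hd γ a).trans hσ)
    hθ.ratio_nonneg hθ.ratio_le_one (fun k => ?_) (fun k => ?_)
  · rw [avg_smul, avg_consensusErr hm, smul_zero]
  · have h0 := (hθ.pos k).ne'
    rw [show prevInv θ (k + 1) = 1 / θ k from rfl, h.step_x, consensusErr_add, consensusErr_smul,
      consensusErr_smul, consensusErr_mix (hW₃.row_sum _) (hW₃.col_sum _), smul_add, smul_smul,
      smul_smul, hθ.inv_mul_one_sub, one_div_mul_cancel h0, one_smul, mix_smul, smul_smul]
    abel

theorem IsAccGradientTracking.sq_consensusErr_y_le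
    (h : IsAccGradientTracking 0 α θ W₁ W₂ W₃ f x y z s) (hθ : IsNesterovSeq θ) (k : ℕ) :
    (1 / θ k) ^ 2 * frobSq (consensusErr (y k)) ≤ 2 * frobNorm (consensusErr (z k)) ^ 2
      + 2 * frobNorm (prevInv θ k • consensusErr (x k)) ^ 2 := by
  have h0 := hθ.pos k
  have e : (1 / θ k) • consensusErr (y k) = consensusErr (z k)
      + (θ k * prevInv θ k) • (prevInv θ k • consensusErr (x k)) := by
    rw [h.step_y, consensusErr_add, consensusErr_smul, consensusErr_smul, smul_add, smul_smul,
      smul_smul, smul_smul, hθ.inv_mul_one_sub, one_div_mul_cancel h0.ne', one_smul]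
  have h1 : frobNorm ((1 / θ k) • consensusErr (y k)) ≤ frobNorm (consensusErr (z k))
      + frobNorm (prevInv θ k • consensusErr (x k)) := by
    rw [e]
    refine (frobNorm_add_le _ _).trans (add_le_add le_rfl ?_)
    rw [frobNorm_smul (θ k * prevInv θ k), abs_of_nonneg (hθ.ratio_nonneg k)]
    exact mul_le_of_le_one_left (frobNorm_nonneg _) (hθ.ratio_le_one k)
  have h2 : (1 / θ k) ^ 2 * frobSq (consensusErr (y k))
      = frobNorm ((1 / θ k) • consensusErr (y k)) ^ 2 := by
    rw [frobNorm_smul, mul_pow, sq_abs, frobNorm_sq]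
  rw [h2]
  have h3 := pow_le_pow_left₀ (frobNorm_nonneg _) h1 2
  nlinarith [sq_nonneg (frobNorm (consensusErr (z k))
    - frobNorm (prevInv θ k • consensusErr (x k)))]

/-- The change of the local gradients, split at the average of the new `x`: one part is a Bregman
divergence, the other is a movement of `z` and a consensus error. -/
theorem IsAccGradientTracking.sq_grad_change_le
    (h : IsAccGradientTracking 0 α θ W₁ W₂ W₃ f x y z s) (hm : 1 ≤ m) (hL : 0 < L)
    (hf : ∀ i, StronglyConvexSmooth 0 L (f i)) (hW₃ : TimeVaryingWeights E₃ W₃ γ)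
    (hθ : IsNesterovSeq θ) (k : ℕ) :
    (1 / θ k) ^ 2 * frobNorm (consensusErr (aggGrad f (y (k + 1)) - aggGrad f (y k))) ^ 2
      ≤ 8 * L * m * (prevInv θ (k + 1) ^ 2 * bregman f (y (k + 1)) (avg (x (k + 1))))
        + 2 * L ^ 2 * m * ‖avg (z (k + 1)) - avg (z k)‖ ^ 2
        + 2 * L ^ 2 * ((1 / θ k) ^ 2 * frobSq (consensusErr (y k))) := by
  have h0 := hθ.pos k
  set w := avg (x (k + 1)) with hw
  have h1 := sum_sq_gradient_sub_le hm hL hf (y (k + 1)) w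
  have h2 : ∑ i, ‖gradient (f i) w - gradient (f i) (y k i)‖ ^ 2
      ≤ L ^ 2 * (m * (θ k ^ 2 * ‖avg (z (k + 1)) - avg (z k)‖ ^ 2)
        + frobSq (consensusErr (y k))) := by
    have e : w - avg (y k) = θ k • (avg (z (k + 1)) - avg (z k)) := by
      rw [hw, h.avg_x hW₃, h.avg_y, smul_sub]
      abel
    have e2 := sum_sq_dist hm (y k) w
    rw [e, norm_smul, mul_pow, Real.norm_eq_abs, sq_abs] at e2
    rw [← e2, Finset.mul_sum]
    refine Finset.sum_le_sum fun i _ => ?_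
    rw [← mul_pow]
    exact pow_le_pow_left₀ (norm_nonneg _) ((hf i).lipschitz_gradient _ _) 2
  have h3 : frobNorm (consensusErr (aggGrad f (y (k + 1)) - aggGrad f (y k))) ^ 2
      ≤ 2 * ∑ i, ‖gradient (f i) w - gradient (f i) (y (k + 1) i)‖ ^ 2
        + 2 * ∑ i, ‖gradient (f i) w - gradient (f i) (y k i)‖ ^ 2 := by
    rw [frobNorm_sq]
    refine (frobSq_consensusErr_le hm _).trans ?_
    rw [frobSq, Finset.mul_sum, Finset.mul_sum, ← Finset.sum_add_distrib]
    refine Finset.sum_le_sum fun i _ => ?_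
    have e : (aggGrad f (y (k + 1)) - aggGrad f (y k)) i
        = (gradient (f i) w - gradient (f i) (y k i))
          - (gradient (f i) w - gradient (f i) (y (k + 1) i)) := by
      simp only [aggGrad, Pi.sub_apply]
      abel
    rw [e]
    have t1 := pow_le_pow_left₀ (norm_nonneg _)
      (norm_sub_le (gradient (f i) w - gradient (f i) (y k i))
        (gradient (f i) w - gradient (f i) (y (k + 1) i))) 2
    nlinarith [sq_nonneg (‖gradient (f i) w - gradient (f i) (y k i)‖
      - ‖gradient (f i) w - gradient (f i) (y (k + 1) i)‖)]
  have h4 := mul_le_mul_of_nonneg_left (h3.trans (add_le_add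
    (mul_le_mul_of_nonneg_left h1 zero_le_two) (mul_le_mul_of_nonneg_left h2 zero_le_two)))
    (sq_nonneg (1 / θ k))
  refine h4.trans_eq ?_
  rw [show prevInv θ (k + 1) = 1 / θ k from rfl]
  field_simp
  ring

/-- Total consensus error of `y` and `x`, rescaled by the parameters, in terms of the trackers:
each of the mixing recursions for `z` and `x` amplifies square sums by `2 (γ / (1 - σ))²`. -/
theorem IsAccGradientTracking.sum_consensusErr_le
    (h : IsAccGradientTracking 0 α θ W₁ W₂ W₃ f x y z s) (hm : 1 ≤ m) (hγ : 1 ≤ γ)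
    (hW₂ : TimeVaryingWeights E₂ W₂ γ) (hW₃ : TimeVaryingWeights E₃ W₃ γ)
    (hθ : IsNesterovSeq θ) {σ : ℝ} (hσ₂ : jointSigma W₂ γ ≤ σ) (hσ₃ : jointSigma W₃ γ ≤ σ)
    (hσ1 : σ < 1) (K : ℕ) :
    ∑ k ∈ Finset.range (K + 1), (1 / θ k) ^ 2 * frobSq (consensusErr (y k))
        + ∑ k ∈ Finset.range (K + 1), prevInv θ k ^ 2 * frobSq (consensusErr (x k))
      ≤ 16 * α ^ 2 * (γ / (1 - σ)) ^ 4
        * ∑ k ∈ Finset.range (K + 1), (1 / θ k) ^ 2 * frobNorm (consensusErr (s k)) ^ 2 := by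
  have hσ0 : 0 ≤ σ := (jointSigma_nonneg W₂ γ).trans hσ₂
  have hs : 0 < 1 - σ := by linarith
  have hz0 : consensusErr (z 0) = 0 := by rw [h.init_z, h.init_consensus]
  set τ := (γ : ℝ) / (1 - σ) with hτ
  have hτ1 : 1 ≤ τ := by
    rw [hτ, one_le_div hs]
    have : (1 : ℝ) ≤ γ := by exact_mod_cast hγ
    linarith
  set S := ∑ k ∈ Finset.range (K + 1), (1 / θ k) ^ 2 * frobNorm (consensusErr (s k)) ^ 2 with hS
  set Z := ∑ k ∈ Finset.range (K + 1), frobNorm (consensusErr (z k)) ^ 2 with hZ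
  set U := ∑ k ∈ Finset.range (K + 1), frobNorm (prevInv θ k • consensusErr (x k)) ^ 2 with hU
  have hZS : Z ≤ 2 * τ ^ 2 * (α ^ 2 * S) := by
    refine ((h.window_z hm hW₂ hσ₂).sum_sq_le_of_zero hγ hσ0 hσ1 ?_ K).trans ?_
    · simp [hz0, frobNorm, frobSq]
    · refine mul_le_mul_of_nonneg_left ?_ (by positivity)
      rw [hS, Finset.mul_sum]
      refine (Finset.sum_le_sum_of_subset_of_nonneg (Finset.range_mono K.le_succ)
        fun _ _ _ => sq_nonneg _).trans_eq (Finset.sum_congr rfl fun k _ => ?_)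
      rw [frobNorm_smul, mul_pow, sq_abs]
      ring
  have hUZ : U ≤ 2 * τ ^ 2 * Z := by
    refine ((h.window_x hm hW₃ hθ hσ₃).sum_sq_le_of_zero hγ hσ0 hσ1 ?_ K).trans ?_
    · simp [prevInv, frobNorm, frobSq]
    · refine mul_le_mul_of_nonneg_left ?_ (by positivity)
      rw [hZ, Finset.sum_range_succ']
      exact le_add_of_nonneg_right (sq_nonneg _)
  have hY : ∑ k ∈ Finset.range (K + 1), (1 / θ k) ^ 2 * frobSq (consensusErr (y k))
      ≤ 2 * Z + 2 * U := by
    rw [hZ, hU, Finset.mul_sum, Finset.mul_sum, ← Finset.sum_add_distrib]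
    exact Finset.sum_le_sum fun k _ => h.sq_consensusErr_y_le hθ k
  have hX : ∑ k ∈ Finset.range (K + 1), prevInv θ k ^ 2 * frobSq (consensusErr (x k)) = U := by
    refine Finset.sum_congr rfl fun k _ => ?_
    rw [frobNorm_smul, mul_pow, sq_abs, frobNorm_sq]
  have hS0 : 0 ≤ α ^ 2 * S :=
    mul_nonneg (sq_nonneg _) (Finset.sum_nonneg fun k _ => by positivity)
  have h2 : 2 * τ ^ 2 * Z ≤ 2 * τ ^ 2 * (2 * τ ^ 2 * (α ^ 2 * S)) := by gcongr
  have h3 : τ ^ 2 * (α ^ 2 * S) ≤ τ ^ 4 * (α ^ 2 * S) :=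
    mul_le_mul_of_nonneg_right (pow_le_pow_right₀ hτ1 (by norm_num)) hS0
  rw [hX]
  linarith

theorem IsAccGradientTracking.sum_grad_change_le
    (h : IsAccGradientTracking 0 α θ W₁ W₂ W₃ f x y z s) (hm : 1 ≤ m) (hL : 0 < L)
    (hf : ∀ i, StronglyConvexSmooth 0 L (f i)) (hW₃ : TimeVaryingWeights E₃ W₃ γ)
    (hθ : IsNesterovSeq θ) (K : ℕ) :
    ∑ k ∈ Finset.range K,
        (1 / θ k) ^ 2 * frobNorm (consensusErr (aggGrad f (y (k + 1)) - aggGrad f (y k))) ^ 2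
      ≤ 8 * L * m * ∑ k ∈ Finset.range (K + 1), prevInv θ k ^ 2 * bregman f (y k) (avg (x k))
        + 2 * L ^ 2 * m * ∑ k ∈ Finset.range (K + 1), ‖avg (z (k + 1)) - avg (z k)‖ ^ 2
        + 2 * L ^ 2 * ∑ k ∈ Finset.range (K + 1), (1 / θ k) ^ 2 * frobSq (consensusErr (y k)) := by
  have h1 := Finset.sum_le_sum fun k (_ : k ∈ Finset.range K) =>
    h.sq_grad_change_le hm hL hf hW₃ hθ k
  rw [Finset.sum_add_distrib, Finset.sum_add_distrib, ← Finset.mul_sum, ← Finset.mul_sum,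
    ← Finset.mul_sum] at h1
  refine h1.trans ?_
  have hD : ∑ k ∈ Finset.range K,
      prevInv θ (k + 1) ^ 2 * bregman f (y (k + 1)) (avg (x (k + 1)))
      ≤ ∑ k ∈ Finset.range (K + 1), prevInv θ k ^ 2 * bregman f (y k) (avg (x k)) := by
    rw [Finset.sum_range_succ' _ K]
    exact le_add_of_nonneg_right (mul_nonneg (sq_nonneg _) (bregman_nonneg hf _ _))
  have hsub := Finset.range_mono K.le_succ
  have hZ : ∑ k ∈ Finset.range K, ‖avg (z (k + 1)) - avg (z k)‖ ^ 2
      ≤ ∑ k ∈ Finset.range (K + 1), ‖avg (z (k + 1)) - avg (z k)‖ ^ 2 :=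
    Finset.sum_le_sum_of_subset_of_nonneg hsub fun _ _ _ => sq_nonneg _
  have hY : ∑ k ∈ Finset.range K, (1 / θ k) ^ 2 * frobSq (consensusErr (y k))
      ≤ ∑ k ∈ Finset.range (K + 1), (1 / θ k) ^ 2 * frobSq (consensusErr (y k)) :=
    Finset.sum_le_sum_of_subset_of_nonneg hsub fun _ _ _ =>
      mul_nonneg (sq_nonneg _) (frobSq_nonneg _)
  gcongr

end Iterates

/-! ### The small-gain estimate -/

/-- The small-gain argument: the total consensus error `V` is driven by the initial tracking error
`M` and by the change of the gradients, hence by `D`, `Δ` and `V` itself, and the loop gain is a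
multiple of `(α L τ⁴)²`. -/
theorem small_gain {m : ℕ} (hm : 1 ≤ m) {L α τ V S G D Δ M : ℝ} (hL : 0 < L) (hα : 0 < α)
    (hτ : 1 ≤ τ) (hstep : α * L * τ ^ 4 ≤ 1 / 21675) (hM : 0 ≤ M) (hD : 0 ≤ D) (hΔ : 0 ≤ Δ)
    (hV : 0 ≤ V) (hVS : V ≤ 16 * α ^ 2 * τ ^ 4 * S) (hSG : S ≤ 8 * τ ^ 3 * M + 14 * τ ^ 4 * G)
    (hG : G ≤ 8 * L * m * D + 2 * L ^ 2 * m * Δ + 2 * L ^ 2 * V) :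
    2 * L / m * V ≤ D + (1 / (2 * α) - L) * Δ + M / (20 * m * L * τ) := by
  have hm0 : (0 : ℝ) < m := by positivity
  have hτ0 : 0 < τ := by linarith
  set c := α * L * τ ^ 4 with hc
  have hc0 : 0 < c := by positivity
  have hc2 : c ^ 2 ≤ 1 / 10 ^ 6 := by
    have := pow_le_pow_left₀ hc0.le hstep 2
    norm_num at this ⊢
    linarith
  have h1 : V ≤ 16 * α ^ 2 * τ ^ 4 * (8 * τ ^ 3 * M
      + 14 * τ ^ 4 * (8 * L * m * D + 2 * L ^ 2 * m * Δ + 2 * L ^ 2 * V)) :=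
    hVS.trans (by gcongr; exact hSG.trans (by gcongr))
  have h2 : L ^ 2 * V ≤ c ^ 2 * (128 * (M / τ)
      + 224 * (8 * L * m * D + 2 * L ^ 2 * m * Δ + 2 * (L ^ 2 * V))) := by
    refine (mul_le_mul_of_nonneg_left h1 (sq_nonneg L)).trans_eq ?_
    rw [hc]
    field_simp
    ring
  have h3 : L ^ 2 * V ≤ 1 / 10 ^ 6 * (128 * (M / τ)
      + 224 * (8 * L * m * D + 2 * L ^ 2 * m * Δ + 2 * (L ^ 2 * V))) :=
    h2.trans (by gcongr)
  have h4 : 2 * L / m * V ≤ D + L * Δ + M / (20 * m * L * τ) := by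
    have e1 : 2 * L / m * V = 2 / (L * m) * (L ^ 2 * V) := by field_simp
    have e2 : D + L * Δ + M / (20 * m * L * τ)
        = 2 / (L * m) * (L * m * D / 2 + L ^ 2 * m * Δ / 2 + (M / τ) / 40) := by
      field_simp
      ring
    rw [e1, e2]
    refine mul_le_mul_of_nonneg_left ?_ (by positivity)
    have p1 : 0 ≤ L * m * D := by positivity
    have p2 : 0 ≤ L ^ 2 * m * Δ := by positivity
    have p3 : 0 ≤ M / τ := by positivity
    linarith
  have h5 : L ≤ 1 / (2 * α) - L := by
    have : α * L ≤ 1 / 4 := by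
      have : α * L ≤ c := le_mul_of_one_le_right (by positivity) (one_le_pow₀ hτ)
      linarith
    have : 2 * L ≤ 1 / (2 * α) := by
      rw [le_div_iff₀ (by positivity)]
      linarith
    linarith
  have h6 := mul_le_mul_of_nonneg_right h5 hΔ
  linarith

end AccGT

theorem theorem3 {m n γ : ℕ} (hm : 1 ≤ m)
    (f : Fin m → EuclideanSpace ℝ (Fin n) → ℝ) (L α σ : ℝ) (hL : 0 < L)
    (hf : ∀ i, AccGT.StronglyConvexSmooth 0 L (f i))
    (E₁ E₂ E₃ : ℕ → Set (Fin m × Fin m)) (W₁ W₂ W₃ : ℕ → Matrix (Fin m) (Fin m) ℝ)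
    (hW₁ : AccGT.TimeVaryingWeights E₁ W₁ γ) (hW₂ : AccGT.TimeVaryingWeights E₂ W₂ γ)
    (hW₃ : AccGT.TimeVaryingWeights E₃ W₃ γ)
    (hσ : σ = max (max (AccGT.jointSigma W₁ γ) (AccGT.jointSigma W₂ γ)) (AccGT.jointSigma W₃ γ))
    (θ : ℕ → ℝ) (hθ : AccGT.IsNesterovSeq θ)
    (hα : 0 < α) (hα_le : α ≤ (1 - σ) ^ 4 / (21675 * L * (γ : ℝ) ^ 4))
    (x y z s : ℕ → AccGT.Agg m n)
    (halg : AccGT.IsAccGradientTracking 0 α θ W₁ W₂ W₃ f x y z s)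
    (xstar : EuclideanSpace ℝ (Fin n))
    (hxstar : ∀ w, AccGT.objective f xstar ≤ AccGT.objective f w) (T : ℕ) :
    AccGT.objective f (AccGT.avg (x (T * γ + 1))) - AccGT.objective f xstar ≤
        1 / ((T : ℝ) * γ + 1) ^ 2 *
          (2 / α * ‖AccGT.avg (z 0) - xstar‖ ^ 2 +
            (1 - σ) / (5 * m * L * γ) *
              (Finset.range (γ + 1)).sup' Finset.nonempty_range_add_one
                (fun r => AccGT.frobSq (AccGT.consensusErr (s r)))) ∧
      1 / (m : ℝ) * AccGT.frobSq (AccGT.consensusErr (x (T * γ))) ≤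
        9 / (2 * L * ((T : ℝ) * γ + 1) ^ 2) *
          (2 / α * ‖AccGT.avg (z 0) - xstar‖ ^ 2 +
            (1 - σ) / (5 * m * L * γ) *
              (Finset.range (γ + 1)).sup' Finset.nonempty_range_add_one
                (fun r => AccGT.frobSq (AccGT.consensusErr (s r)))) := by
  open AccGT in
  set M := (Finset.range (γ + 1)).sup' Finset.nonempty_range_add_one
    (fun r => frobSq (consensusErr (s r)))
  have hm0 : (0 : ℝ) < m := by positivity
  have hγ : 1 ≤ γ := hW₁.one_le_gamma
  have hγ0 : (1 : ℝ) ≤ γ := by exact_mod_cast hγ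
  have hσ₁ : jointSigma W₁ γ ≤ σ := hσ ▸ (le_max_left _ _).trans (le_max_left _ _)
  have hσ₂ : jointSigma W₂ γ ≤ σ := hσ ▸ (le_max_right _ _).trans (le_max_left _ _)
  have hσ₃ : jointSigma W₃ γ ≤ σ := hσ ▸ le_max_right _ _
  have hσ1 : σ < 1 := hσ ▸ max_lt (max_lt hW₁.jointSigma_lt_one hW₂.jointSigma_lt_one)
    hW₃.jointSigma_lt_one
  have hσ0 : 0 ≤ σ := (jointSigma_nonneg W₁ γ).trans hσ₁
  have hs : 0 < 1 - σ := by linarith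
  have hM : ∀ k < γ, frobNorm (consensusErr (s k)) ^ 2 ≤ M := by
    intro k hk
    rw [frobNorm_sq]
    exact Finset.le_sup' (fun r => frobSq (consensusErr (s r)))
      (Finset.mem_range.2 (hk.trans γ.lt_succ_self))
  have hM0 : 0 ≤ M := (sq_nonneg _).trans (hM 0 hγ)
  obtain ⟨τ, hτ⟩ : ∃ τ : ℝ, τ = γ / (1 - σ) := ⟨_, rfl⟩
  have hτ1 : 1 ≤ τ := by
    rw [hτ, one_le_div hs]
    linarith
  have hτ0 : 0 < τ := by linarith
  have hstep : α * L * τ ^ 4 ≤ 1 / 21675 := by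
    calc α * L * τ ^ 4 ≤ (1 - σ) ^ 4 / (21675 * L * (γ : ℝ) ^ 4) * L * τ ^ 4 := by gcongr
      _ = 1 / 21675 := by
        rw [hτ]
        field_simp
  set K := T * γ with hK
  have hcast : (T : ℝ) * γ = K := by
    rw [hK]
    push_cast
    rfl
  have hdesc := halg.sum_descent hm hf hW₁ hW₂ hW₃ hθ hα xstar (K + 1)
  have hVS := halg.sum_consensusErr_le hm hγ hW₂ hW₃ hθ hσ₂ hσ₃ hσ1 K
  have hSG := (halg.window_s hm hW₁ hσ₁).sum_weighted_sq_le hγ hσ0 hσ1 (t := fun k => 1 / θ k)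
    (by simp [hθ.zero]) hθ.one_le_inv hθ.inv_succ_le hM K
  have hG := halg.sum_grad_change_le hm hL hf hW₃ hθ K
  rw [← hτ] at hVS hSG
  set Y := ∑ k ∈ Finset.range (K + 1), (1 / θ k) ^ 2 * frobSq (consensusErr (y k))
  set U := ∑ k ∈ Finset.range (K + 1), prevInv θ k ^ 2 * frobSq (consensusErr (x k))
  set D := ∑ k ∈ Finset.range (K + 1), prevInv θ k ^ 2 * bregman f (y k) (avg (x k))
  set Δ := ∑ k ∈ Finset.range (K + 1), ‖avg (z (k + 1)) - avg (z k)‖ ^ 2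
  have hY0 : 0 ≤ Y := Finset.sum_nonneg fun _ _ => mul_nonneg (sq_nonneg _) (frobSq_nonneg _)
  have hU0 : 0 ≤ U := Finset.sum_nonneg fun _ _ => mul_nonneg (sq_nonneg _) (frobSq_nonneg _)
  have hD0 : 0 ≤ D :=
    Finset.sum_nonneg fun _ _ => mul_nonneg (sq_nonneg _) (bregman_nonneg hf _ _)
  have hΔ0 : 0 ≤ Δ := Finset.sum_nonneg fun _ _ => sq_nonneg _
  have hgain := small_gain hm hL hα hτ1 hstep hM0 hD0 hΔ0 (add_nonneg hY0 hU0) hVS hSG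
    (hG.trans (by gcongr; exact le_add_of_nonneg_right hU0))
  -- A single bound `R` controls both the objective gap and the consensus error of `x`.
  set R := 1 / (2 * α) * ‖avg (z 0) - xstar‖ ^ 2 + M / (20 * m * L * τ) with hR
  have hRR : 2 / α * ‖avg (z 0) - xstar‖ ^ 2 + (1 - σ) / (5 * m * L * γ) * M = 4 * R := by
    rw [hR, hτ]
    field_simp
    ring
  set e := objective f (avg (x (K + 1))) - objective f xstar with he
  have he0 : 0 ≤ e := sub_nonneg.2 (hxstar _)
  have hbudget : (1 / θ K) ^ 2 * e + L / m * U ≤ R := by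
    rw [show prevInv θ (K + 1) = 1 / θ K from rfl] at hdesc
    have h1 : 0 ≤ 1 / (2 * α) * ‖avg (z (K + 1)) - xstar‖ ^ 2 := by positivity
    have h2 : 2 * L / m * (Y + U) = L / m * Y + L / m * U + L / m * Y + L / m * U := by ring
    have h3 : 0 ≤ L / m * Y := by positivity
    have h4 : 0 ≤ L / m * U := by positivity
    linarith
  rw [hRR, hcast]
  constructor
  · have h1 : ((K : ℝ) + 1) / 2 ≤ 1 / θ K := le_trans (by linarith) (hθ.half_le_inv K)
    have h2 : (((K : ℝ) + 1) / 2) ^ 2 * e ≤ R := by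
      have h3 : (((K : ℝ) + 1) / 2) ^ 2 * e ≤ (1 / θ K) ^ 2 * e := by gcongr
      have h4 : 0 ≤ L / m * U := by positivity
      linarith
    rw [one_div_mul_eq_div, le_div_iff₀ (by positivity)]
    linarith
  · have h1 : (((K : ℝ) + 1) / 2) ^ 2 * frobSq (consensusErr (x K))
        ≤ prevInv θ K ^ 2 * frobSq (consensusErr (x K)) := by
      rcases Nat.eq_zero_or_pos K with h0 | hpos
      · rw [h0, halg.init_consensus]
        simp [frobSq]
      · obtain ⟨j, hj⟩ := Nat.exists_eq_succ_of_ne_zero hpos.ne'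
        have h2 := hθ.half_le_inv j
        have h3 : ((K : ℝ) + 1) / 2 ≤ prevInv θ K := by
          rw [hj]
          change _ ≤ 1 / θ j
          push_cast
          linarith
        have := frobSq_nonneg (consensusErr (x K))
        gcongr
    have h2 : prevInv θ K ^ 2 * frobSq (consensusErr (x K)) ≤ U :=
      Finset.single_le_sum (f := fun k => prevInv θ k ^ 2 * frobSq (consensusErr (x k)))
        (fun _ _ => mul_nonneg (sq_nonneg _) (frobSq_nonneg _))
        (Finset.mem_range.2 K.lt_succ_self)
    have h3 : L / m * ((((K : ℝ) + 1) / 2) ^ 2 * frobSq (consensusErr (x K))) ≤ R := by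
      have h4 : L / m * ((((K : ℝ) + 1) / 2) ^ 2 * frobSq (consensusErr (x K))) ≤ L / m * U := by
        gcongr
        exact h1.trans h2
      have h5 : 0 ≤ (1 / θ K) ^ 2 * e := by positivity
      linarith
    have hR0 : 0 ≤ R := by positivity
    have h4 : 1 / (m : ℝ) * frobSq (consensusErr (x K))
        = 4 / (L * ((K : ℝ) + 1) ^ 2)
          * (L / m * ((((K : ℝ) + 1) / 2) ^ 2 * frobSq (consensusErr (x K)))) := by
      field_simp
      ring
    rw [h4]
    calc 4 / (L * ((K : ℝ) + 1) ^ 2)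
          * (L / m * ((((K : ℝ) + 1) / 2) ^ 2 * frobSq (consensusErr (x K))))
        ≤ 4 / (L * ((K : ℝ) + 1) ^ 2) * R := by gcongr
      _ ≤ 18 / (L * ((K : ℝ) + 1) ^ 2) * R := by gcongr; norm_num
      _ = 9 / (2 * L * ((K : ℝ) + 1) ^ 2) * (4 * R) := by
        field_simp
        ring
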